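/- Let $d\ge 1$ and let $C\subset\mathbb{R}^d$ be an open convex set whose boundary $M:=\partial C$ is a smooth compact submanifold of dimension $d-1$. Let $X:=\mathbb{R}^d\setminus C$ and let $d_M(x,y)$ be the infimum of the Euclidean lengths $\int_0^1|\dot\gamma(t)|\,dt$ of the Lipschitz curves $\gamma:[0,1]\to X$ with $\gamma(0)=x$, $\gamma(1)=y$. Let $\mu,\nu$ be Borel probability measures on $X$ with $\mu\ll\mathcal{L}^d$, let $\pi$ be an optimal transference plan of finite cost between $\mu$ and $\nu$ for the cost $d_M$, and let $\varphi$ be a potential of $\pi$: $\varphi(x)-\varphi(y)\le d_M(x,y)$ for all $x,y\in X$, and $\pi(G)=1$, where $$G:=\{(x,y)\in X\times X:\ \varphi(x)-\varphi(y)=d_M(x,y)\}.$$ Write $G(x)=\{y:(x,y)\in G\}$, $G^{-1}=\{(x,y):(y,x)\in G\}$, $R:=G\cup G^{-1}$. Let $\mathcal{T}_e$ be the set of $x$ such that $(x,y)\in R$ for some $y\ne x$, and let $\mathcal{T}$ be the set of $x$ for which there are $y\neq x$ and $y'\ne x$ with $(y,x)\in G$ and $(x,y')\in G$. Let $H$ be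 the set of the pairs $(x,y)\in\mathcal{T}_e\times\mathcal{T}_e$ for which there are $I\ge 0$ and points $z_0=x,z_1,\dots,z_I,z_{I+1}=y$ with $z_1,\dots,z_I\in\mathcal{T}$ and $(z_i,z_{i+1})\in R$ for $0\le i\le I$; its restriction to $\mathcal{T}$ is an equivalence relation. Assume that $\mu(\{w:G(w)\cap M\neq\emptyset\})=1$. A disintegration of a probability measure $\rho$ on a measurable space $(Y,\mathcal{Y})$ consistent with a map $r:Y\to Z$ into a measurable space is a family $(\rho_s)_{s\in Z}$ of probability measures on $Y$ such that, for every $B\in\mathcal{Y}$, the function $s\mapsto\rho_s(B)$ is $r_\sharp\rho$-measurable and $\rho(B\cap r^{-1}(D))=\int_D\rho_s(B)\,(r_\sharp\rho)(ds)$ for all measurable $D\subset Z$. Let $q$ be a $\mu$-measurable quotient map for $H$, that is, a map from $\mathbb{R}^d$ to a measurable space $S$ such that for $x,x'\in\mathcal{T}$ one has $q(x)=q(x')$ if and only if $(x,x')\in H$. Put $m_H:=q_\sharp\mu$, and let $(\mu_y)_{y\in S}$ be a disintegration of $\mu$ consistent with $q$. Let $f^M$ be the contact map: $f^M(w)$ is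 the point $z\in M\cap G(w)$ at which $d_M(w,z)$ is minimal, whenever there is exactly one such point (and, say, $f^M(w)=w$ otherwise). Put $m_{\mu_y}:=f^M_\sharp\mu_y$ and, for $m_H$-a.e. $y$, let $(\mu_{y,z})_z$ be a disintegration of $\mu_y$ consistent with $f^M$. Then for $m_H$-a.e. $y\in S$, for $m_{\mu_y}$-a.e. $z$, the measure $\mu_{y,z}$ is continuous (atomless): $\mu_{y,z}(\{x\})=0$ for every $x$. -/

import Mathlib

open MeasureTheory
open scoped ENNReal

namespace ObstacleProblem

/-- Euclidean space `ℝᵈ`. -/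
abbrev Space (d : ℕ) : Type := EuclideanSpace ℝ (Fin d)

/-- `M` is a smooth embedded hypersurface: near each of its points it is the zero set of a
smooth function whose differential does not vanish. -/
def IsSmoothHypersurface {d : ℕ} (M : Set (Space d)) : Prop :=
  ∀ p ∈ M, ∃ U : Set (Space d), IsOpen U ∧ p ∈ U ∧ ∃ ρ : Space d → ℝ,
    ContDiffOn ℝ (⊤ : ℕ∞) ρ U ∧ (∀ x ∈ U, fderiv ℝ ρ x ≠ 0) ∧ M ∩ U = {x ∈ U | ρ x = 0}

/-- The obstacle: an open convex set whose boundary is a smooth compact hypersurface.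
The ambient space of the transport problem is `X = Cᶜ`, and `M = frontier C`. -/
structure IsObstacle {d : ℕ} (C : Set (Space d)) : Prop where
  isOpen : IsOpen C
  convex : Convex ℝ C
  isCompact_frontier : IsCompact (frontier C)
  smooth_frontier : IsSmoothHypersurface (frontier C)

/-- Lipschitz curves `[0,1] → X = Cᶜ` from `x` to `y`. -/
structure IsAdmissible {d : ℕ} (C : Set (Space d)) (x y : Space d) (γ : ℝ → Space d) : Prop where
  lipschitz : ∃ K, LipschitzOnWith K γ (Set.Icc 0 1)
  notMem : ∀ t ∈ Set.Icc (0 : ℝ) 1, γ t ∉ C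
  source : γ 0 = x
  target : γ 1 = y

/-- Euclidean arc length `∫₀¹ |γ'(t)| dt`. -/
noncomputable def curveLength {d : ℕ} (γ : ℝ → Space d) : ℝ≥0∞ :=
  ∫⁻ t in Set.Icc (0 : ℝ) 1, ‖deriv γ t‖ₑ

/-- The geodesic distance `d_M` on `X = Cᶜ`. -/
noncomputable def obstacleDist {d : ℕ} (C : Set (Space d)) (x y : Space d) : ℝ≥0∞ :=
  ⨅ (γ : ℝ → Space d) (_ : IsAdmissible C x y γ), curveLength γ

/-- `π` is a transference plan with marginals `μ` and `ν`. -/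
def IsPlan {d : ℕ} (μ ν : Measure (Space d)) (π : Measure (Space d × Space d)) : Prop :=
  π.map Prod.fst = μ ∧ π.map Prod.snd = ν

/-- `π` is an optimal transference plan, of finite cost, for the cost `d_M`. -/
structure IsOptimalPlan {d : ℕ} (C : Set (Space d)) (μ ν : Measure (Space d))
    (π : Measure (Space d × Space d)) : Prop where
  isPlan : IsPlan μ ν π
  cost_ne_top : ∫⁻ p, obstacleDist C p.1 p.2 ∂π ≠ ∞
  optimal : ∀ π', IsPlan μ ν π' →
    ∫⁻ p, obstacleDist C p.1 p.2 ∂π ≤ ∫⁻ p, obstacleDist C p.1 p.2 ∂π'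

/-- The set of oriented transport rays
`G = {(x, y) ∈ X × X : φ x - φ y = d_M (x, y)}` of the potential `φ`. -/
def rayGraph {d : ℕ} (C : Set (Space d)) (φ : Space d → ℝ) : Set (Space d × Space d) :=
  {p | p.1 ∉ C ∧ p.2 ∉ C ∧ φ p.2 ≤ φ p.1 ∧ obstacleDist C p.1 p.2 = ENNReal.ofReal (φ p.1 - φ p.2)}

/-- `φ` is a potential of the plan `π`: it is `1`-Lipschitz on `X` for `d_M`, and `π` is
concentrated on the transport rays of `φ`. -/
structure IsPotential {d : ℕ} (C : Set (Space d)) (π : Measure (Space d × Space d))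
    (φ : Space d → ℝ) : Prop where
  lipschitz : ∀ x ∉ C, ∀ y ∉ C, ENNReal.ofReal (φ x - φ y) ≤ obstacleDist C x y
  concentrated : ∀ᵐ p ∂π, p ∈ rayGraph C φ

/-- The set of (non-oriented) transport rays `R = G ∪ G⁻¹`. -/
def rays {d : ℕ} (C : Set (Space d)) (φ : Space d → ℝ) : Set (Space d × Space d) :=
  {p | p ∈ rayGraph C φ ∨ p.swap ∈ rayGraph C φ}

/-- The transport set without end points: some nontrivial ray arrives and some nontrivial ray
leaves. -/
def transportSet {d : ℕ} (C : Set (Space d)) (φ : Space d → ℝ) : Set (Space d) :=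
  {x | (∃ y, y ≠ x ∧ (y, x) ∈ rayGraph C φ) ∧ ∃ y, y ≠ x ∧ (x, y) ∈ rayGraph C φ}

/-- The transport set with end points. -/
def transportSetE {d : ℕ} (C : Set (Space d)) (φ : Space d → ℝ) : Set (Space d) :=
  {x | (∃ y, y ≠ x ∧ (y, x) ∈ rayGraph C φ) ∨ ∃ y, y ≠ x ∧ (x, y) ∈ rayGraph C φ}

/-- The relation `H` (chains of transport rays): `x` and `y` are joined by finitely many
transport rays whose successive common points `z₁, …, z_I` are not end points. -/
def chains {d : ℕ} (C : Set (Space d)) (φ : Space d → ℝ) : Set (Space d × Space d) :=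
  {p | p.1 ∈ transportSetE C φ ∧ p.2 ∈ transportSetE C φ ∧
    ∃ (I : ℕ) (z : ℕ → Space d), z 0 = p.1 ∧ z (I + 1) = p.2 ∧
      (∀ i, 1 ≤ i → i ≤ I → z i ∈ transportSet C φ) ∧
      ∀ i ≤ I, (z i, z (i + 1)) ∈ rays C φ}

/-- `q` is a `μ`-measurable quotient map for the equivalence relation induced by `H` on the
transport set. The points `y` of `S` label the classes; one may take for `S` the set of classes
with the push-forward σ-algebra, or the Borel image of a measurable cross-section. -/
structure IsQuotientMap {d : ℕ} (C : Set (Space d)) (φ : Space d → ℝ) (μ : Measure (Space d))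
    {S : Type*} [MeasurableSpace S] (q : Space d → S) : Prop where
  aemeasurable : AEMeasurable q μ
  eq_iff : ∀ x ∈ transportSet C φ, ∀ x' ∈ transportSet C φ, q x = q x' ↔ (x, x') ∈ chains C φ

/-- `s ↦ κ s` is a disintegration of `ρ` consistent with the map `r`. -/
structure IsDisintegration {R S : Type*} [MeasurableSpace R] [MeasurableSpace S]
    (ρ : Measure R) (r : R → S) (κ : S → Measure R) : Prop where
  isProbabilityMeasure : ∀ s, IsProbabilityMeasure (κ s)
  aemeasurable : ∀ B, MeasurableSet B → AEMeasurable (fun s => κ s B) (ρ.map r)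
  consistent : ∀ B D, MeasurableSet B → MeasurableSet D →
    ρ (B ∩ r ⁻¹' D) = ∫⁻ s in D, κ s B ∂(ρ.map r)

/-- `z` is a contact point of `w`: a point of `M = frontier C` on a ray that leaves `w`, as close
to `w` (for `d_M`) as possible. -/
def IsContactPoint {d : ℕ} (C : Set (Space d)) (φ : Space d → ℝ) (w z : Space d) : Prop :=
  (z ∈ frontier C ∧ (w, z) ∈ rayGraph C φ) ∧
    ∀ z' ∈ frontier C, (w, z') ∈ rayGraph C φ → obstacleDist C w z ≤ obstacleDist C w z'

open Classical in
/-- The map that sends `w` to its contact point, if there is exactly one (and to `w` otherwise). -/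
noncomputable def contactMap {d : ℕ} (C : Set (Space d)) (φ : Space d → ℝ) (w : Space d) :
    Space d :=
  if h : ∃! z, IsContactPoint C φ w z then h.exists.choose else w

end ObstacleProblem

/-!
The argument combines a volume estimate for the transport along rays with the fact that an atom
of a conditional measure produces a measurable set that meets every ray at most once.

*Geometry of rays.* Off the closed obstacle `φ` is locally `1`-Lipschitz for the Euclidean
distance, hence almost everywhere differentiable. If a ray leaves such a point `w` towards the
boundary, it is the straight line with direction `-∇φ(w)` until it first hits the obstacle, and the
hitting point is the unique contact point of `w` (`IsObstacleLipschitz.isRegular`). Shortest curves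
are not needed: nearly shortest curves provide a direction of descent (`exists_direction`), and the
strict triangle inequality prevents the ray from turning
(`IsObstacleLipschitz.add_obstacleDist_le`).

*Volume estimate.* In the middle of two rays of length `2 s` the direction is `s⁻¹`-Lipschitz
(`IsRegular.mul_norm_sub_le`), so that moving a set for a time `s` along its rays divides its volume
by at most `2 ^ d`. If a measurable set meets every ray at most once, its images at different
times are disjoint; they stay in a bounded region, so that the set is negligible
(`volume_eq_zero_of_ray_subsingleton`). Applied to the set of initial points of rays, this shows
that almost every point belongs to the transport set without end points. Applied to a set on which
the pair of the quotient map and the contact map is injective, it shows that such a set is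
negligible, because both maps are constant along the part of a ray before the contact.

*Atoms.* The iterated disintegration is essentially given by a kernel with parameters in
`S × ℝᵈ`, whose atoms are covered by countably many measurable graphs over the parameters
(`exists_graphs_cover_atoms`). Each graph corresponds to a measurable set of points on which the
pair of maps is injective, hence it is negligible for almost all conditional measures
(`ae_ae_atomless_of_injOn_null`). Separability of the σ-algebra of `S` plays no role.
-/

namespace ObstacleProblem

open MeasureTheory ProbabilityTheory Set Filter Topology
open scoped NNReal ENNReal

variable {d : ℕ} {C : Set (Space d)}

/-! ### Curve length and the obstacle distance -/

/-- A Lipschitz curve is at least as long as its chord. -/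
lemma edist_le_lintegral_enorm_deriv {γ : ℝ → Space d} {a b : ℝ} (hab : a ≤ b) {K : ℝ≥0}
    (hγ : LipschitzOnWith K γ (Icc a b)) :
    edist (γ a) (γ b) ≤ ∫⁻ t in Icc a b, ‖deriv γ t‖ₑ := by
  set v : Space d := γ b - γ a with hv
  rcases eq_or_ne v 0 with h0 | h0
  · rw [sub_eq_zero.1 h0, edist_self]
    exact zero_le
  have hdiff : ∀ᵐ t, t ∈ Icc a b → DifferentiableAt ℝ γ t := by
    have h1 : ∀ᵐ t : ℝ, t ≠ a := by simp [ae_iff]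
    have h2 : ∀ᵐ t : ℝ, t ≠ b := by simp [ae_iff]
    filter_upwards [hγ.ae_differentiableWithinAt_of_mem_real, h1, h2] with t ht hta htb hmem
    exact (ht hmem).differentiableAt
      (Icc_mem_nhds (lt_of_le_of_ne hmem.1 hta.symm) (lt_of_le_of_ne hmem.2 htb))
  set g : ℝ → ℝ := fun t => inner ℝ v (γ t) with hg
  have hgL : LipschitzOnWith (‖v‖₊ * K) g (uIcc a b) := by
    rw [uIcc_of_le hab]
    refine LipschitzOnWith.of_dist_le_mul fun x hx y hy => ?_
    have h1 : g x - g y = inner ℝ v (γ x - γ y) := by simp [hg, inner_sub_right]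
    rw [Real.dist_eq, h1]
    calc |inner ℝ v (γ x - γ y)| ≤ ‖v‖ * ‖γ x - γ y‖ := abs_real_inner_le_norm _ _
      _ ≤ ‖v‖ * (K * dist x y) := by
        gcongr
        rw [← dist_eq_norm]
        exact hγ.dist_le_mul _ hx _ hy
      _ = _ := by push_cast; ring
  have hftc := hgL.absolutelyContinuousOnInterval.integral_deriv_eq_sub
  have hgv : g b - g a = ‖v‖ ^ 2 := by
    rw [← real_inner_self_eq_norm_sq, hg]; simp only; rw [← inner_sub_right]
  have hle : ENNReal.ofReal (‖v‖ ^ 2) ≤ ‖v‖ₑ * ∫⁻ t in Icc a b, ‖deriv γ t‖ₑ := by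
    calc ENNReal.ofReal (‖v‖ ^ 2) = ‖∫ t in a..b, deriv g t‖ₑ := by
          rw [hftc, hgv, Real.enorm_eq_ofReal (by positivity)]
      _ = ‖∫ t in Icc a b, deriv g t‖ₑ := by
          rw [intervalIntegral.integral_of_le hab, integral_Icc_eq_integral_Ioc]
      _ ≤ ∫⁻ t in Icc a b, ‖deriv g t‖ₑ := enorm_integral_le_lintegral_enorm _
      _ ≤ ∫⁻ t in Icc a b, ‖v‖ₑ * ‖deriv γ t‖ₑ := by
          refine setLIntegral_mono_ae' measurableSet_Icc ?_
          filter_upwards [hdiff] with t ht hmem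
          have h1 : deriv g t = inner ℝ v (deriv γ t) := by
            have := (hasDerivAt_const t v).inner ℝ (ht hmem).hasDerivAt
            simpa using this.deriv
          rw [h1, ← ofReal_norm, ← ofReal_norm, ← ofReal_norm,
            ← ENNReal.ofReal_mul (norm_nonneg _)]
          exact ENNReal.ofReal_le_ofReal (norm_inner_le_norm _ _)
      _ = _ := lintegral_const_mul' _ _ (by simp)
  have hve : ‖v‖ₑ ≠ 0 := by simpa using h0
  rw [edist_comm, edist_eq_enorm_sub, ← hv]
  rw [pow_two, ENNReal.ofReal_mul (norm_nonneg _), ofReal_norm] at hle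
  exact (ENNReal.mul_le_mul_iff_right hve (by simp)).1 hle

lemma edist_le_obstacleDist (x y : Space d) : edist x y ≤ obstacleDist C x y := by
  refine le_iInf₂ fun γ hγ => ?_
  obtain ⟨K, hK⟩ := hγ.lipschitz
  simpa [hγ.source, hγ.target, curveLength] using
    edist_le_lintegral_enorm_deriv zero_le_one hK

/-- On a segment that avoids the obstacle, the obstacle distance is at most the Euclidean one. -/
lemma obstacleDist_le_edist {x y : Space d} (h : segment ℝ x y ⊆ Cᶜ) :
    obstacleDist C x y ≤ edist x y := by
  set γ : ℝ → Space d := fun t => AffineMap.lineMap x y t with hγ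
  have hderiv : ∀ t, deriv γ t = y - x := fun t => by
    have : HasDerivAt γ (y - x) t := by simpa using AffineMap.hasDerivAt_lineMap (a := x) (b := y)
    exact this.deriv
  have hadm : IsAdmissible C x y γ :=
    { lipschitz := ⟨nndist x y, (lipschitzWith_lineMap x y).lipschitzOnWith⟩
      notMem := fun t ht => h (by
        rw [segment_eq_image_lineMap]
        exact ⟨t, ht, rfl⟩)
      source := by simp [hγ]
      target := by simp [hγ] }
  refine (iInf₂_le γ hadm).trans ?_
  simp [curveLength, hderiv, edist_comm x y, edist_eq_enorm_sub]

lemma obstacleDist_eq_edist {x y : Space d} (h : segment ℝ x y ⊆ Cᶜ) :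
    obstacleDist C x y = edist x y :=
  (obstacleDist_le_edist h).antisymm (edist_le_obstacleDist x y)

/-- The length of a piece of a curve is invariant under increasing affine reparametrization. -/
lemma lintegral_enorm_deriv_comp_affine (γ : ℝ → Space d) {c : ℝ} (hc : 0 < c) (a l r : ℝ) :
    ∫⁻ t in Icc l r, ‖deriv (fun t => γ (c * t + a)) t‖ₑ
      = ∫⁻ s in Icc (c * l + a) (c * r + a), ‖deriv γ s‖ₑ := by
  have himg : (fun t => c * t + a) '' Icc l r = Icc (c * l + a) (c * r + a) :=
    image_affine_Icc' hc a l r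
  have hder : ∀ t, HasDerivAt (fun t => c * t + a) c t := fun t => by
    simpa using ((hasDerivAt_id t).const_mul c).add_const a
  rw [← himg, lintegral_image_eq_lintegral_abs_deriv_mul measurableSet_Icc
    (fun t _ => (hder t).hasDerivWithinAt)
    (fun s _ t _ h => by simpa [hc.ne'] using h)]
  refine lintegral_congr fun t => ?_
  have h1 : deriv (fun t => γ (c * t + a)) t = c • deriv γ (c * t + a) := by
    rw [deriv_comp_mul_left c (fun s => γ (s + a)) t, deriv_comp_add_const]
  rw [h1, enorm_smul, abs_of_pos hc, Real.enorm_eq_ofReal hc.le]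

/-- The triangle inequality: two curves are run through one after the other. -/
lemma obstacleDist_triangle (x y z : Space d) :
    obstacleDist C x z ≤ obstacleDist C x y + obstacleDist C y z := by
  unfold obstacleDist
  refine ENNReal.le_iInf₂_add_iInf₂ fun γ hγ η hη => ?_
  obtain ⟨K, hK⟩ := hγ.lipschitz
  obtain ⟨L, hL⟩ := hη.lipschitz
  set ζ : ℝ → Space d := fun t => if t ≤ 1 / 2 then γ (2 * t + 0) else η (2 * t + -1) with hζ
  have hleft : ∀ t ≤ (1 / 2 : ℝ), ζ t = γ (2 * t) := fun t ht => by
    simp only [hζ, if_pos ht, add_zero]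
  have hright : ∀ t, (1 / 2 : ℝ) ≤ t → ζ t = η (2 * t - 1) := fun t ht => by
    rcases ht.eq_or_lt with rfl | h
    · simp [hζ, hγ.target, hη.source]
    · simp only [hζ, if_neg h.not_ge, sub_eq_add_neg]
  have hmono : ∀ s ∈ Icc (0 : ℝ) 1, ∀ t ∈ Icc (0 : ℝ) 1, s ≤ t →
      dist (ζ s) (ζ t) ≤ 2 * (K + L) * (t - s) := by
    have hl : ∀ s t, 0 ≤ s → s ≤ t → t ≤ (1 / 2 : ℝ) → dist (ζ s) (ζ t) ≤ 2 * K * (t - s) := by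
      intro s t h0 hst ht
      rw [hleft s (hst.trans ht), hleft t ht]
      refine (hK.dist_le_mul _ ⟨by linarith, by linarith⟩ _ ⟨by linarith, by linarith⟩).trans
        (le_of_eq ?_)
      rw [dist_comm, Real.dist_eq, abs_of_nonneg (by linarith)]; ring
    have hr : ∀ s t, (1 / 2 : ℝ) ≤ s → s ≤ t → t ≤ 1 → dist (ζ s) (ζ t) ≤ 2 * L * (t - s) := by
      intro s t h0 hst ht
      rw [hright s h0, hright t (h0.trans hst)]
      refine (hL.dist_le_mul _ ⟨by linarith, by linarith⟩ _ ⟨by linarith, by linarith⟩).trans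
        (le_of_eq ?_)
      rw [dist_comm, Real.dist_eq, abs_of_nonneg (by linarith)]; ring
    have hK0 : (0 : ℝ) ≤ K := K.2
    have hL0 : (0 : ℝ) ≤ L := L.2
    intro s hs t ht hst
    rcases le_total t (1 / 2) with h | h
    · refine (hl s t hs.1 hst h).trans ?_
      gcongr
      linarith
    · rcases le_total s (1 / 2) with h' | h'
      · refine (dist_triangle _ (ζ (1 / 2)) _).trans ?_
        nlinarith [hl s (1 / 2) hs.1 h' le_rfl, hr (1 / 2) t le_rfl h ht.2,
          mul_nonneg hL0 (sub_nonneg.2 h'), mul_nonneg hK0 (sub_nonneg.2 h)]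
      · refine (hr s t h' hst ht.2).trans ?_
        gcongr
        linarith
  have hadm : IsAdmissible C x z ζ :=
    { lipschitz := by
        refine ⟨2 * (K + L), LipschitzOnWith.of_dist_le_mul fun s hs t ht => ?_⟩
        push_cast
        rcases le_total s t with h | h
        · rw [dist_comm s t, Real.dist_eq, abs_of_nonneg (sub_nonneg.2 h)]
          exact hmono s hs t ht h
        · rw [Real.dist_eq, abs_of_nonneg (sub_nonneg.2 h), dist_comm]
          exact hmono t ht s hs h
      notMem := fun t ht => by
        rcases le_total t (1 / 2) with h | h
        · rw [hleft t h]; exact hγ.notMem _ ⟨by linarith [ht.1], by linarith⟩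
        · rw [hright t h]; exact hη.notMem _ ⟨by linarith, by linarith [ht.2]⟩
      source := by rw [hleft 0 (by norm_num), mul_zero, hγ.source]
      target := by rw [hright 1 (by norm_num)]; norm_num [hη.target] }
  refine (iInf₂_le ζ hadm).trans (le_of_eq ?_)
  have hsplit : Icc (0 : ℝ) 1 = Ico 0 (1 / 2) ∪ Icc (1 / 2) 1 :=
    (Ico_union_Icc_eq_Icc (by norm_num) (by norm_num)).symm
  have hdisj : Disjoint (Ico (0 : ℝ) (1 / 2)) (Icc (1 / 2) 1) :=
    Set.disjoint_left.2 fun t h1 h2 => h1.2.not_ge h2.1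
  unfold curveLength
  rw [hsplit, lintegral_union measurableSet_Icc hdisj, ← hsplit]
  congr 1
  · have h1 : ∀ t ∈ Ico (0 : ℝ) (1 / 2), ‖deriv ζ t‖ₑ = ‖deriv (fun t => γ (2 * t + 0)) t‖ₑ := by
      intro t ht
      congr 1
      refine Filter.EventuallyEq.deriv_eq ?_
      filter_upwards [Iio_mem_nhds ht.2] with s hs
      simp only [hζ, if_pos (le_of_lt (mem_Iio.1 hs))]
    rw [setLIntegral_congr_fun measurableSet_Ico h1, restrict_Ico_eq_restrict_Icc,
      lintegral_enorm_deriv_comp_affine γ two_pos]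
    norm_num
  · rw [← restrict_Ioc_eq_restrict_Icc (a := (1 / 2 : ℝ))]
    have h1 : ∀ t ∈ Ioc (1 / 2 : ℝ) 1, ‖deriv ζ t‖ₑ = ‖deriv (fun t => η (2 * t + -1)) t‖ₑ := by
      intro t ht
      congr 1
      refine Filter.EventuallyEq.deriv_eq ?_
      filter_upwards [Ioi_mem_nhds ht.1] with s hs
      simp only [hζ, if_neg (not_le.2 (mem_Ioi.1 hs))]
    rw [setLIntegral_congr_fun measurableSet_Ioc h1, restrict_Ioc_eq_restrict_Icc,
      lintegral_enorm_deriv_comp_affine η two_pos]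
    norm_num

/-- Cutting an admissible curve at one of its points: the first piece is at least as long as its
chord, the second one is a competitor for the distance from the cutting point. -/
lemma IsAdmissible.edist_add_obstacleDist_le {x z : Space d} {γ : ℝ → Space d}
    (hγ : IsAdmissible C x z γ) {t : ℝ} (ht : t ∈ Icc (0 : ℝ) 1) :
    edist x (γ t) + obstacleDist C (γ t) z ≤ curveLength γ := by
  obtain ⟨K, hK⟩ := hγ.lipschitz
  have hfirst : edist x (γ t) ≤ ∫⁻ s in Icc 0 t, ‖deriv γ s‖ₑ := by
    simpa [hγ.source] using edist_le_lintegral_enorm_deriv ht.1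
      (hK.mono (Icc_subset_Icc le_rfl ht.2))
  have hsecond : obstacleDist C (γ t) z ≤ ∫⁻ s in Icc t 1, ‖deriv γ s‖ₑ := by
    rcases ht.2.eq_or_lt with rfl | h1
    · rw [hγ.target]
      have hz : z ∉ C := hγ.target ▸ hγ.notMem 1 ⟨zero_le_one, le_rfl⟩
      refine (obstacleDist_le_edist (by simpa using hz)).trans ?_
      simp
    · have hc : 0 < 1 - t := sub_pos.2 h1
      have hmaps : ∀ s ∈ Icc (0 : ℝ) 1, (1 - t) * s + t ∈ Icc (0 : ℝ) 1 := fun s hs =>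
        ⟨by nlinarith [hs.1, ht.1], by nlinarith [hs.2]⟩
      have hadm : IsAdmissible C (γ t) z (fun s => γ ((1 - t) * s + t)) :=
        { lipschitz := by
            refine ⟨K, LipschitzOnWith.of_dist_le_mul fun r hr s hs => ?_⟩
            refine (hK.dist_le_mul _ (hmaps r hr) _ (hmaps s hs)).trans ?_
            gcongr
            rw [dist_add_right, Real.dist_eq, Real.dist_eq, ← mul_sub, abs_mul, abs_of_pos hc]
            exact mul_le_of_le_one_left (abs_nonneg _) (by linarith [ht.1])
          notMem := fun s hs => hγ.notMem _ (hmaps s hs)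
          source := by simp
          target := by simp [hγ.target] }
      refine (iInf₂_le _ hadm).trans (le_of_eq ?_)
      rw [curveLength, lintegral_enorm_deriv_comp_affine γ hc]
      simp
  calc edist x (γ t) + obstacleDist C (γ t) z
      ≤ (∫⁻ s in Icc 0 t, ‖deriv γ s‖ₑ) + ∫⁻ s in Icc t 1, ‖deriv γ s‖ₑ := by gcongr
    _ = (∫⁻ s in Ico 0 t, ‖deriv γ s‖ₑ) + ∫⁻ s in Icc t 1, ‖deriv γ s‖ₑ := by
      rw [restrict_Ico_eq_restrict_Icc]
    _ = curveLength γ := by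
      rw [curveLength, ← Ico_union_Icc_eq_Icc ht.1 ht.2, lintegral_union measurableSet_Icc
        (Set.disjoint_left.2 fun s h1 h2 => h1.2.not_ge h2.1)]

/-- The obstacle distance to `z` drops at full speed in some direction: nearly shortest curves
leave a ball that avoids the obstacle, and a limit of their exit points does the job. -/
lemma exists_direction {p z : Space d} {r : ℝ} (hr : 0 < r)
    (hball : Metric.closedBall p r ⊆ Cᶜ) (hz : r ≤ dist p z)
    (hfin : obstacleDist C p z ≠ ∞) :
    ∃ e : Space d, ‖e‖ = 1 ∧
      ∀ s ∈ Icc 0 r, ENNReal.ofReal s + obstacleDist C (p + s • e) z ≤ obstacleDist C p z := by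
  have hseg : ∀ x ∈ Metric.closedBall p r, ∀ y ∈ Metric.closedBall p r,
      obstacleDist C x y = edist x y := fun x hx y hy =>
    obstacleDist_eq_edist (((convex_closedBall p r).segment_subset hx hy).trans hball)
  have hexit : ∀ n : ℕ, ∃ y ∈ Metric.sphere p r, ENNReal.ofReal r + obstacleDist C y z ≤
      obstacleDist C p z + (n + 1 : ℝ≥0∞)⁻¹ := by
    intro n
    have hlt : obstacleDist C p z < obstacleDist C p z + (n + 1 : ℝ≥0∞)⁻¹ :=
      ENNReal.lt_add_right hfin (by simp)
    obtain ⟨γ, hlt⟩ := iInf_lt_iff.1 hlt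
    obtain ⟨hγ, hlt⟩ := iInf_lt_iff.1 hlt
    obtain ⟨K, hK⟩ := hγ.lipschitz
    have hcont : ContinuousOn (fun t => dist p (γ t)) (Icc 0 1) :=
      (continuous_const.dist continuous_id).comp_continuousOn hK.continuousOn
    obtain ⟨t, ht, hrt⟩ := intermediate_value_Icc zero_le_one hcont
      (show r ∈ Icc _ _ by simpa [hγ.source, hγ.target] using ⟨hr.le, hz⟩)
    refine ⟨γ t, by rw [Metric.mem_sphere, dist_comm]; exact hrt, ?_⟩
    have h1 := hγ.edist_add_obstacleDist_le ht
    rw [edist_dist, show dist p (γ t) = r from hrt] at h1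
    exact h1.trans hlt.le
  choose y hy hyle using hexit
  obtain ⟨x, hx, ψ, hψ, hlim⟩ := (isCompact_sphere p r).tendsto_subseq hy
  have hxle : ENNReal.ofReal r + obstacleDist C x z ≤ obstacleDist C p z := by
    have hupper : Tendsto (fun n => edist x (y (ψ n)) +
        (obstacleDist C p z + ((ψ n : ℕ) + 1 : ℝ≥0∞)⁻¹)) atTop
        (𝓝 (0 + (obstacleDist C p z + 0))) := by
      refine Tendsto.add ?_ (Tendsto.add tendsto_const_nhds ?_)
      · have := (tendsto_const_nhds (x := x)).edist hlim
        simpa using this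
      · have h1 : Tendsto (fun n : ℕ => ((n : ℝ≥0∞) + 1)⁻¹) atTop (𝓝 0) := by
          have := (tendsto_add_atTop_iff_nat 1).2 ENNReal.tendsto_inv_nat_nhds_zero
          simpa using this
        exact h1.comp hψ.tendsto_atTop
    rw [zero_add, add_zero] at hupper
    refine ge_of_tendsto' hupper fun n => ?_
    calc ENNReal.ofReal r + obstacleDist C x z
        ≤ ENNReal.ofReal r + (edist x (y (ψ n)) + obstacleDist C (y (ψ n)) z) := by
          gcongr
          rw [← hseg x (Metric.sphere_subset_closedBall hx) _
            (Metric.sphere_subset_closedBall (hy (ψ n)))]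
          exact obstacleDist_triangle _ _ _
      _ = edist x (y (ψ n)) + (ENNReal.ofReal r + obstacleDist C (y (ψ n)) z) := by ring
      _ ≤ _ := add_le_add le_rfl (hyle _)
  have hxn : ‖x - p‖ = r := by rw [← dist_eq_norm]; exact hx
  refine ⟨r⁻¹ • (x - p), ?_, fun s hs => ?_⟩
  · rw [norm_smul, hxn, Real.norm_of_nonneg (by positivity), inv_mul_cancel₀ hr.ne']
  set q := p + s • r⁻¹ • (x - p) with hq
  have hqx : dist q x = r - s := by
    have : q - x = -((1 - s * r⁻¹) • (x - p)) := by rw [hq]; module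
    have h1 : s * r⁻¹ ≤ 1 := by
      rw [← div_eq_mul_inv, div_le_one hr]; exact hs.2
    rw [dist_eq_norm, this, norm_neg, norm_smul, hxn, Real.norm_of_nonneg (by linarith)]
    field_simp
  have hqp : q ∈ Metric.closedBall p r := by
    rw [Metric.mem_closedBall, dist_eq_norm, hq, add_sub_cancel_left, norm_smul, norm_smul, hxn,
      norm_inv, Real.norm_of_nonneg hr.le, inv_mul_cancel₀ hr.ne', mul_one,
      Real.norm_of_nonneg hs.1]
    exact hs.2
  calc ENNReal.ofReal s + obstacleDist C q z
      ≤ ENNReal.ofReal s + (obstacleDist C q x + obstacleDist C x z) := by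
        gcongr; exact obstacleDist_triangle _ _ _
    _ = ENNReal.ofReal r + obstacleDist C x z := by
        rw [hseg q hqp x (Metric.sphere_subset_closedBall hx), edist_dist, hqx, ← add_assoc,
          ← ENNReal.ofReal_add hs.1 (sub_nonneg.2 hs.2), add_sub_cancel]
    _ ≤ _ := hxle

/-! ### Rays of a potential before their contact with the obstacle -/

/-- `φ` is `1`-Lipschitz on the complement of the obstacle, for the obstacle distance. -/
def IsObstacleLipschitz (C : Set (Space d)) (φ : Space d → ℝ) : Prop :=
  ∀ x ∉ C, ∀ y ∉ C, ENNReal.ofReal (φ x - φ y) ≤ obstacleDist C x y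

variable {φ : Space d → ℝ}

lemma IsObstacleLipschitz.sub_le_dist (hφ : IsObstacleLipschitz C φ) {x y : Space d}
    (h : segment ℝ x y ⊆ Cᶜ) : φ x - φ y ≤ dist x y := by
  have h1 := hφ x (h (left_mem_segment ℝ x y)) y (h (right_mem_segment ℝ x y))
  rw [obstacleDist_eq_edist h, edist_dist] at h1
  exact (ENNReal.ofReal_le_ofReal_iff dist_nonneg).1 h1

lemma IsObstacleLipschitz.lipschitzOnWith (hφ : IsObstacleLipschitz C φ) {B : Set (Space d)}
    (hB : Convex ℝ B) (hBC : B ⊆ Cᶜ) : LipschitzOnWith 1 φ B := by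
  refine LipschitzOnWith.of_le_add fun x hx y hy => ?_
  have := hφ.sub_le_dist ((hB.segment_subset hx hy).trans hBC)
  linarith

/-- Along a ray to `z`, the potential decreases at least as fast as the distance to `z`. -/
lemma IsObstacleLipschitz.le_sub_of_mem_rayGraph (hφ : IsObstacleLipschitz C φ)
    {w y z : Space d} (hG : (w, z) ∈ rayGraph C φ) (hy : y ∉ C) {t : ℝ}
    (h : ENNReal.ofReal t + obstacleDist C y z ≤ obstacleDist C w z) : φ y ≤ φ w - t := by
  obtain ⟨-, hz, hle, heq⟩ := hG
  have h1 : ENNReal.ofReal (t + (φ y - φ z)) ≤ ENNReal.ofReal (φ w - φ z) := by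
    calc ENNReal.ofReal (t + (φ y - φ z))
        ≤ ENNReal.ofReal t + ENNReal.ofReal (φ y - φ z) := ENNReal.ofReal_add_le
      _ ≤ ENNReal.ofReal t + obstacleDist C y z := add_le_add le_rfl (hφ y hy z hz)
      _ ≤ obstacleDist C w z := h
      _ = _ := heq
  have h2 := (ENNReal.ofReal_le_ofReal_iff (sub_nonneg.2 hle)).1 h1
  linarith

lemma mem_rayGraph_of_segment {x y : Space d} (h : segment ℝ x y ⊆ Cᶜ)
    (heq : φ x - φ y = dist x y) : (x, y) ∈ rayGraph C φ := by
  refine ⟨h (left_mem_segment ℝ x y), h (right_mem_segment ℝ x y), ?_, ?_⟩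
  · have := dist_nonneg (x := x) (y := y)
    simp only
    linarith
  · rw [obstacleDist_eq_edist h, edist_dist]
    simp only [heq]

lemma dist_add_smul_add_smul {w u : Space d} (hu : ‖u‖ = 1) (s t : ℝ) :
    dist (w + s • u) (w + t • u) = |s - t| := by
  rw [dist_eq_norm, add_sub_add_left_eq_sub, ← sub_smul, norm_smul, hu, mul_one, Real.norm_eq_abs]

lemma segment_add_smul_subset {B : Set (Space d)} {w u : Space d} {I : Set ℝ} (hI : Convex ℝ I)
    (hB : ∀ t ∈ I, w + t • u ∈ B) {s t : ℝ} (hs : s ∈ I) (ht : t ∈ I) :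
    segment ℝ (w + s • u) (w + t • u) ⊆ B := by
  rintro x ⟨a, b, ha, hb, hab, rfl⟩
  have h1 : a • (w + s • u) + b • (w + t • u) = w + (a * s + b * t) • u := by
    calc a • (w + s • u) + b • (w + t • u) = (a + b) • w + (a * s + b * t) • u := by module
      _ = _ := by rw [hab, one_smul]
  rw [h1]
  exact hB _ (hI hs ht ha hb hab)

/-- Unit vectors whose sum has norm at least `2` are equal. -/
lemma eq_of_two_le_norm_add {u e : Space d} (hu : ‖u‖ = 1) (he : ‖e‖ = 1) (h : 2 ≤ ‖u + e‖) :
    e = u := by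
  have h1 := parallelogram_law_with_norm ℝ u e
  rw [hu, he] at h1
  have h2 : ‖u - e‖ = 0 := by
    have := norm_nonneg (u - e)
    nlinarith
  exact (sub_eq_zero.1 (norm_eq_zero.1 h2)).symm

lemma exists_closedBall_subset_compl {p : Space d} (hp : p ∉ closure C) :
    ∃ r > 0, Metric.closedBall p r ⊆ (closure C)ᶜ :=
  Metric.nhds_basis_closedBall.mem_iff.1 (isClosed_closure.isOpen_compl.mem_nhds hp)

/-- The direction `-∇φ` of the ray that leaves a point where `φ` is differentiable. -/
noncomputable def rayDir (φ : Space d → ℝ) (w : Space d) : Space d := -gradient φ w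

/-- A `1`-Lipschitz function that is differentiable at `p` decreases at unit speed in at most one
direction. -/
lemma IsObstacleLipschitz.rayDir_eq (hφ : IsObstacleLipschitz C φ) {p e : Space d}
    (hp : p ∉ closure C) (hd : DifferentiableAt ℝ φ p) (he : ‖e‖ = 1) {r : ℝ} (hr : 0 < r)
    (hdec : ∀ s ∈ Icc 0 r, φ (p + s • e) = φ p - s) : rayDir φ p = e := by
  set g := gradient φ p with hg
  have hgrad : HasGradientAt φ g p := hd.hasGradientAt
  have hnorm : ‖g‖ ≤ 1 := by
    obtain ⟨ρ, hρ, hball⟩ := exists_closedBall_subset_compl hp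
    have hL := hφ.lipschitzOnWith (convex_closedBall p ρ)
      (hball.trans (compl_subset_compl.2 subset_closure))
    have h1 : ‖InnerProductSpace.toDual ℝ (Space d) g‖ ≤ 1 := by
      refine hgrad.hasFDerivAt.le_of_lip' zero_le_one ?_
      filter_upwards [Metric.closedBall_mem_nhds p hρ] with x hx
      simpa [dist_eq_norm] using hL.dist_le_mul x hx p (Metric.mem_closedBall_self hρ.le)
    simpa using h1
  have hinner : inner ℝ g e = -1 := by
    have hline : HasDerivAt (fun s : ℝ => p + s • e) e 0 := by
      simpa using ((hasDerivAt_id (0 : ℝ)).smul_const e).const_add p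
    have h1 : HasDerivAt (fun s : ℝ => φ (p + s • e)) (inner ℝ g e) 0 := by
      have h0 : HasFDerivAt φ (InnerProductSpace.toDual ℝ (Space d) g) (p + (0 : ℝ) • e) := by
        simpa using hgrad.hasFDerivAt
      simpa [Function.comp_def] using h0.comp_hasDerivAt (0 : ℝ) hline
    have h2 : HasDerivWithinAt (fun s : ℝ => φ (p + s • e)) (-1) (Icc 0 r) 0 := by
      refine HasDerivWithinAt.congr (f := fun s => φ p - s) ?_ hdec (hdec 0 ⟨le_rfl, hr.le⟩)
      simpa using ((hasDerivAt_id (0 : ℝ)).const_sub (φ p)).hasDerivWithinAt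
    exact (uniqueDiffOn_Icc hr 0 ⟨le_rfl, hr.le⟩).eq_deriv _ h1.hasDerivWithinAt h2
  have h0 : ‖g + e‖ ^ 2 ≤ 0 := by
    rw [norm_add_sq_real, hinner, he]
    nlinarith [norm_nonneg g]
  have h1 : g + e = 0 := by
    have : ‖g + e‖ = 0 := by nlinarith [norm_nonneg (g + e)]
    exact norm_eq_zero.1 this
  rw [rayDir, ← hg]
  exact neg_eq_of_add_eq_zero_right h1

/-- A ray to a point `z` of the boundary of the obstacle goes straight as long as it stays off the
obstacle: the initial direction is propagated by the strict triangle inequality. -/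
lemma IsObstacleLipschitz.add_obstacleDist_le (hφ : IsObstacleLipschitz C φ) {w u z : Space d}
    (hz : z ∈ frontier C) (hG : (w, z) ∈ rayGraph C φ) (hu : ‖u‖ = 1) {T : ℝ}
    (hfree : ∀ t ∈ Icc 0 T, w + t • u ∉ C) (hfree' : ∀ t ∈ Ico 0 T, w + t • u ∉ closure C)
    (hdir : ∀ e : Space d, ‖e‖ = 1 → ∀ r > 0, (∀ s ∈ Icc 0 r,
      ENNReal.ofReal s + obstacleDist C (w + s • e) z ≤ obstacleDist C w z) → e = u) :
    ∀ t ∈ Icc 0 T, ENNReal.ofReal t + obstacleDist C (w + t • u) z ≤ obstacleDist C w z := by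
  have hfin : obstacleDist C w z ≠ ∞ := by rw [hG.2.2.2]; exact ENNReal.ofReal_ne_top
  set P : Set ℝ := {t | ENNReal.ofReal t + obstacleDist C (w + t • u) z ≤ obstacleDist C w z}
    with hP
  have hseg : ∀ s ∈ Icc 0 T, ∀ t ∈ Icc 0 T,
      segment ℝ (w + s • u) (w + t • u) ⊆ Cᶜ := fun s hs t ht =>
    segment_add_smul_subset (convex_Icc 0 T) (B := Cᶜ) hfree hs ht
  refine IsClosed.Icc_subset_of_forall_mem_nhdsWithin (s := P) ?_ ?_ ?_
  · refine IsSeqClosed.isClosed fun x t hx hlim => ?_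
    have ht : t ∈ Icc 0 T :=
      isClosed_Icc.mem_of_tendsto hlim (Eventually.of_forall fun n => (hx n).2)
    refine ⟨?_, ht⟩
    have hupper : Tendsto (fun n => ENNReal.ofReal |t - x n| + ENNReal.ofReal |t - x n|
        + obstacleDist C w z) atTop (𝓝 (0 + 0 + obstacleDist C w z)) := by
      have h0 : Tendsto (fun n => ENNReal.ofReal |t - x n|) atTop (𝓝 0) := by
        have h1 : Tendsto (fun n => |t - x n|) atTop (𝓝 |t - t|) :=
          (tendsto_const_nhds.sub hlim).abs
        simpa using ENNReal.tendsto_ofReal h1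
      exact (h0.add h0).add tendsto_const_nhds
    rw [zero_add, zero_add] at hupper
    refine ge_of_tendsto' hupper fun n => ?_
    calc ENNReal.ofReal t + obstacleDist C (w + t • u) z
        ≤ (ENNReal.ofReal |t - x n| + ENNReal.ofReal (x n))
          + (ENNReal.ofReal |t - x n| + obstacleDist C (w + x n • u) z) := by
          refine add_le_add ?_ ?_
          · rw [← ENNReal.ofReal_add (abs_nonneg _) (hx n).2.1]
            exact ENNReal.ofReal_le_ofReal (by linarith [le_abs_self (t - x n)])
          · rw [← dist_add_smul_add_smul (w := w) hu, ← edist_dist,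
              ← obstacleDist_eq_edist (hseg t ht _ (hx n).2)]
            exact obstacleDist_triangle _ _ _
      _ = ENNReal.ofReal |t - x n| + ENNReal.ofReal |t - x n|
          + (ENNReal.ofReal (x n) + obstacleDist C (w + x n • u) z) := by ring
      _ ≤ _ := add_le_add le_rfl (hx n).1
  · simp [hP]
  · rintro t ⟨htP, ht⟩
    have htT : t ∈ Icc 0 T := ⟨ht.1, ht.2.le⟩
    set p := w + t • u with hp
    obtain ⟨r, hr, hball⟩ := exists_closedBall_subset_compl (hfree' t ht)
    have hballC : Metric.closedBall p r ⊆ Cᶜ := hball.trans (compl_subset_compl.2 subset_closure)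
    have hzr : r ≤ dist p z := by
      by_contra! h
      exact hball (Metric.mem_closedBall'.2 h.le) (frontier_subset_closure hz)
    have hpfin : obstacleDist C p z ≠ ∞ :=
      ne_top_of_le_ne_top hfin (le_trans le_add_self htP)
    obtain ⟨e, he, hdec⟩ := exists_direction hr hballC hzr hpfin
    have hstep : ∀ s ∈ Icc 0 r,
        ENNReal.ofReal (t + s) + obstacleDist C (p + s • e) z ≤ obstacleDist C w z := by
      intro s hs
      rw [ENNReal.ofReal_add ht.1 hs.1, add_assoc]
      exact (add_le_add le_rfl (hdec s hs)).trans htP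
    have heu : e = u := by
      rcases ht.1.eq_or_lt with h0 | h0
      · refine hdir e he r hr fun s hs => ?_
        have hpw : p = w := by rw [hp, ← h0, zero_smul, add_zero]
        have := hdec s hs
        rwa [hpw] at this
      · set s := min t r with hs
        have hs0 : 0 < s := lt_min h0 hr
        have hsr : s ∈ Icc 0 r := ⟨hs0.le, min_le_right _ _⟩
        have hst : t - s ∈ Icc 0 T :=
          ⟨sub_nonneg.2 (min_le_left _ _), by linarith [ht.2.le]⟩
        have hfwd : p + s • e ∈ Metric.closedBall p r := by
          rw [Metric.mem_closedBall, dist_eq_norm, add_sub_cancel_left, norm_smul, he, mul_one,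
            Real.norm_of_nonneg hs0.le]
          exact hsr.2
        have hbwd : w + (t - s) • u ∈ Metric.closedBall p r := by
          rw [Metric.mem_closedBall, hp, dist_add_smul_add_smul hu, abs_sub_comm,
            sub_sub_cancel, abs_of_pos hs0]
          exact hsr.2
        have h1 : φ (p + s • e) ≤ φ w - (t + s) :=
          hφ.le_sub_of_mem_rayGraph hG (hballC hfwd) (hstep s hsr)
        have h2 : φ w - φ (w + (t - s) • u) ≤ t - s := by
          have h3 := hφ.sub_le_dist (hseg 0 ⟨le_rfl, ht.1.trans ht.2.le⟩ _ hst)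
          rw [dist_add_smul_add_smul hu, zero_sub, abs_neg, abs_of_nonneg hst.1] at h3
          simpa using h3
        have h3 := hφ.sub_le_dist
          (((convex_closedBall p r).segment_subset hbwd hfwd).trans hballC)
        have h4 : dist (w + (t - s) • u) (p + s • e) = s * ‖u + e‖ := by
          have : w + (t - s) • u - (p + s • e) = -(s • (u + e)) := by rw [hp]; module
          rw [dist_eq_norm, this, norm_neg, norm_smul, Real.norm_of_nonneg hs0.le]
        rw [h4] at h3
        refine eq_of_two_le_norm_add hu he ?_
        by_contra! h
        nlinarith
    rw [heu] at hstep
    refine mem_of_superset (Ioo_mem_nhdsGT (show t < t + r by linarith)) fun s hs => ?_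
    have := hstep (s - t) ⟨by linarith [hs.1], by linarith [hs.2]⟩
    have h5 : p + (s - t) • u = w + s • u := by rw [hp]; module
    rwa [add_sub_cancel, h5] at this

/-- The time at which the straight line that leaves `w` with velocity `-∇φ(w)` first meets the
closed obstacle (and `0` if it never does). -/
noncomputable def hitTime (C : Set (Space d)) (φ : Space d → ℝ) (w : Space d) : ℝ :=
  sInf {t | 0 ≤ t ∧ w + t • rayDir φ w ∈ closure C}

/-- `w` is off the closed obstacle, and the ray that leaves it is the straight segment with
direction `-∇φ(w)` until it reaches the obstacle, in the contact point of `w`. -/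
structure IsRegular (C : Set (Space d)) (φ : Space d → ℝ) (w : Space d) : Prop where
  differentiableAt : DifferentiableAt ℝ φ w
  norm_rayDir : ‖rayDir φ w‖ = 1
  hitTime_pos : 0 < hitTime C φ w
  notMem_closure : ∀ t ∈ Ico 0 (hitTime C φ w), w + t • rayDir φ w ∉ closure C
  hit : w + hitTime C φ w • rayDir φ w ∈ closure C
  potential_eq : ∀ t ∈ Icc 0 (hitTime C φ w), φ (w + t • rayDir φ w) = φ w - t
  contactMap_eq : contactMap C φ w = w + hitTime C φ w • rayDir φ w

lemma isClosed_setOf_hit (w u : Space d) :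
    IsClosed {t : ℝ | 0 ≤ t ∧ w + t • u ∈ closure C} :=
  isClosed_Ici.inter (isClosed_closure.preimage (by fun_prop : Continuous fun t : ℝ => w + t • u))

lemma hitTime_le {w : Space d} {t : ℝ} (ht : 0 ≤ t) (h : w + t • rayDir φ w ∈ closure C) :
    hitTime C φ w ≤ t :=
  csInf_le ⟨0, fun _ hs => hs.1⟩ ⟨ht, h⟩

/-- A point of differentiability with a ray to the boundary of the obstacle is regular; in
particular its contact point exists and is unique. -/
theorem IsObstacleLipschitz.isRegular (hφ : IsObstacleLipschitz C φ) (hC : IsOpen C)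
    {w : Space d} (hw : w ∉ closure C) (hd : DifferentiableAt ℝ φ w)
    (hM : ∃ z ∈ frontier C, (w, z) ∈ rayGraph C φ) : IsRegular C φ w := by
  have hcl : ∀ x, x ∉ closure C → x ∉ C := fun x hx h => hx (subset_closure h)
  set u := rayDir φ w with hu_def
  -- every ray from `w` to the boundary starts in the direction `u`
  have hdir : ∀ z, (w, z) ∈ rayGraph C φ → ∀ e : Space d, ‖e‖ = 1 → ∀ r > 0, (∀ s ∈ Icc 0 r,
      ENNReal.ofReal s + obstacleDist C (w + s • e) z ≤ obstacleDist C w z) → e = u := by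
    intro z hG e he r hr hdec
    obtain ⟨ρ, hρ, hball⟩ := exists_closedBall_subset_compl hw
    have hballC : Metric.closedBall w ρ ⊆ Cᶜ := hball.trans (compl_subset_compl.2 subset_closure)
    refine (hφ.rayDir_eq hw hd he (lt_min hr hρ) fun s hs => ?_).symm
    have hmem : w + s • e ∈ Metric.closedBall w ρ := by
      rw [Metric.mem_closedBall, dist_eq_norm, add_sub_cancel_left, norm_smul, he, mul_one,
        Real.norm_of_nonneg hs.1]
      exact hs.2.trans (min_le_right _ _)
    refine le_antisymm (hφ.le_sub_of_mem_rayGraph hG (hballC hmem)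
      (hdec s ⟨hs.1, hs.2.trans (min_le_left _ _)⟩)) ?_
    have h1 := hφ.sub_le_dist (((convex_closedBall w ρ).segment_subset
      (Metric.mem_closedBall_self hρ.le) hmem).trans hballC)
    rw [dist_eq_norm, sub_add_cancel_left, norm_neg, norm_smul, he, mul_one,
      Real.norm_of_nonneg hs.1] at h1
    linarith
  obtain ⟨z, hz, hG⟩ := hM
  have hu : ‖u‖ = 1 := by
    obtain ⟨r, hr, hball⟩ := exists_closedBall_subset_compl hw
    have hzr : r ≤ dist w z := by
      by_contra! h
      exact hball (Metric.mem_closedBall'.2 h.le) (frontier_subset_closure hz)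
    have hfin : obstacleDist C w z ≠ ∞ := by rw [hG.2.2.2]; exact ENNReal.ofReal_ne_top
    obtain ⟨e, he, hdec⟩ := exists_direction hr
      (hball.trans (compl_subset_compl.2 subset_closure)) hzr hfin
    rw [← hdir z hG e he r hr hdec]
    exact he
  -- the line meets the obstacle, since the distance to `z` cannot decrease forever
  have hne : {t : ℝ | 0 ≤ t ∧ w + t • u ∈ closure C}.Nonempty := by
    by_contra! hempty
    have hfree : ∀ t : ℝ, 0 ≤ t → w + t • u ∉ closure C := fun t ht h =>
      (Set.ext_iff.1 hempty t).1 ⟨ht, h⟩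
    have hD := hG.2.2.2
    have hD0 : 0 ≤ φ w - φ z := sub_nonneg.2 hG.2.2.1
    have h1 := hφ.add_obstacleDist_le hz hG hu (T := φ w - φ z + 1)
      (fun t ht => hcl _ (hfree t ht.1)) (fun t ht => hfree t ht.1) (hdir z hG)
      (φ w - φ z + 1) ⟨by linarith, le_rfl⟩
    have h2 := le_self_add.trans h1
    rw [hD] at h2
    have h3 := (ENNReal.ofReal_le_ofReal_iff hD0).1 h2
    linarith
  set τ := hitTime C φ w with hτ
  obtain ⟨hτ0, hτC⟩ : 0 ≤ τ ∧ w + τ • u ∈ closure C :=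
    (isClosed_setOf_hit w u).csInf_mem hne ⟨0, fun _ hs => hs.1⟩
  have hτpos : 0 < τ := by
    refine lt_of_le_of_ne hτ0 fun h => hw ?_
    rw [← h] at hτC
    simpa using hτC
  have hfree' : ∀ t ∈ Ico 0 τ, w + t • u ∉ closure C := fun t ht h =>
    (hitTime_le ht.1 h).not_gt ht.2
  have hhit : w + τ • u ∉ C := by
    intro h
    have hcont : Tendsto (fun t : ℝ => w + t • u) (𝓝[<] τ) (𝓝 (w + τ • u)) :=
      ((by fun_prop : Continuous fun t : ℝ => w + t • u).tendsto τ).mono_left nhdsWithin_le_nhds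
    have hev := hcont.eventually (hC.mem_nhds h)
    obtain ⟨t, htC, ht⟩ := (hev.and (Ioo_mem_nhdsLT hτpos)).exists
    exact hfree' t ⟨ht.1.le, ht.2⟩ (subset_closure htC)
  have hfree : ∀ t ∈ Icc 0 τ, w + t • u ∉ C := fun t ht => by
    rcases ht.2.eq_or_lt with h | h
    · rw [h]; exact hhit
    · exact hcl _ (hfree' t ⟨ht.1, h⟩)
  have hadv : ∀ z' ∈ frontier C, (w, z') ∈ rayGraph C φ → ∀ t ∈ Icc 0 τ,
      ENNReal.ofReal t + obstacleDist C (w + t • u) z' ≤ obstacleDist C w z' :=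
    fun z' hz' hG' => hφ.add_obstacleDist_le hz' hG' hu hfree hfree' (hdir z' hG')
  have hseg : ∀ t ∈ Icc 0 τ, segment ℝ w (w + t • u) ⊆ Cᶜ := fun t ht => by
    simpa using segment_add_smul_subset (convex_Icc 0 τ) (B := Cᶜ) hfree ⟨le_rfl, hτ0⟩ ht
  have hdist : ∀ t ∈ Icc 0 τ, dist w (w + t • u) = t := fun t ht => by
    simpa [abs_of_nonneg ht.1] using dist_add_smul_add_smul (w := w) hu 0 t
  have hpot : ∀ t ∈ Icc 0 τ, φ (w + t • u) = φ w - t := by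
    intro t ht
    refine le_antisymm (hφ.le_sub_of_mem_rayGraph hG (hfree t ht) (hadv z hz hG t ht)) ?_
    have := hφ.sub_le_dist (hseg t ht)
    rw [hdist t ht] at this
    linarith
  have hτmem : τ ∈ Icc 0 τ := ⟨hτ0, le_rfl⟩
  have hdτ : obstacleDist C w (w + τ • u) = ENNReal.ofReal τ := by
    rw [obstacleDist_eq_edist (hseg τ hτmem), edist_dist, hdist τ hτmem]
  have hfront : w + τ • u ∈ frontier C := by
    rw [hC.frontier_eq]
    exact ⟨hτC, hhit⟩
  have hray : (w, w + τ • u) ∈ rayGraph C φ :=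
    mem_rayGraph_of_segment (hseg τ hτmem) (by rw [hdist τ hτmem, hpot τ hτmem]; ring)
  have hcontact : IsContactPoint C φ w (w + τ • u) :=
    ⟨⟨hfront, hray⟩, fun z' hz' hG' => by
      rw [hdτ]
      exact le_self_add.trans (hadv z' hz' hG' τ hτmem)⟩
  have hunique : ∀ z', IsContactPoint C φ w z' → z' = w + τ • u := by
    rintro z' ⟨⟨hz', hG'⟩, hmin⟩
    have h1 := (hadv z' hz' hG' τ hτmem).trans (hmin _ hfront hray)
    rw [hdτ] at h1
    have h2 : obstacleDist C (w + τ • u) z' ≤ 0 :=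
      (ENNReal.add_le_add_iff_left ENNReal.ofReal_ne_top).1 (by simpa using h1)
    have h3 := (edist_le_obstacleDist (w + τ • u) z').trans h2
    exact (edist_le_zero.1 h3).symm
  refine ⟨hd, hu, hτpos, hfree', hτC, hpot, ?_⟩
  have hex : ∃! z', IsContactPoint C φ w z' := ⟨_, hcontact, hunique⟩
  rw [contactMap, dif_pos hex]
  exact hunique _ hex.exists.choose_spec

namespace IsRegular

lemma notMem {w : Space d} (hw : IsRegular C φ w) : w ∉ closure C := by
  simpa using hw.notMem_closure 0 ⟨le_rfl, hw.hitTime_pos⟩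

/-- Regular points of one ray have the same direction, and they differ by the elapsed time. -/
lemma rayDir_and_hitTime_eq (hφ : IsObstacleLipschitz C φ) {w w' : Space d}
    (hw : IsRegular C φ w) (hw' : IsRegular C φ w') {s : ℝ} (hs : s ∈ Ico 0 (hitTime C φ w))
    (h : w' = w + s • rayDir φ w) :
    rayDir φ w' = rayDir φ w ∧ hitTime C φ w' = hitTime C φ w - s := by
  have hadd : ∀ t : ℝ, w' + t • rayDir φ w = w + (s + t) • rayDir φ w := fun t => by
    rw [h]; module
  have hdir : rayDir φ w' = rayDir φ w := by
    refine hφ.rayDir_eq hw'.notMem hw'.differentiableAt hw.norm_rayDir (sub_pos.2 hs.2)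
      fun t ht => ?_
    rw [hadd, hw.potential_eq (s + t) ⟨add_nonneg hs.1 ht.1, by linarith [ht.2]⟩, h,
      hw.potential_eq s ⟨hs.1, hs.2.le⟩]
    ring
  refine ⟨hdir, le_antisymm ?_ ?_⟩
  · refine hitTime_le (sub_nonneg.2 hs.2.le) ?_
    rw [hdir, hadd, add_sub_cancel]
    exact hw.hit
  · have h1 := hw'.hit
    rw [hdir, hadd] at h1
    have := hitTime_le (add_nonneg hs.1 hw'.hitTime_pos.le) h1
    linarith

lemma contactMap_eq_of_ray (hφ : IsObstacleLipschitz C φ) {w w' : Space d}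
    (hw : IsRegular C φ w) (hw' : IsRegular C φ w') {s : ℝ} (hs : s ∈ Ico 0 (hitTime C φ w))
    (h : w' = w + s • rayDir φ w) : contactMap C φ w' = contactMap C φ w := by
  obtain ⟨h1, h2⟩ := rayDir_and_hitTime_eq hφ hw hw' hs h
  rw [hw.contactMap_eq, hw'.contactMap_eq, h1, h2, h]
  module

lemma segment_subset {w : Space d} (hw : IsRegular C φ w) {s t : ℝ}
    (hs : s ∈ Ico 0 (hitTime C φ w)) (ht : t ∈ Ico 0 (hitTime C φ w)) :
    segment ℝ (w + s • rayDir φ w) (w + t • rayDir φ w) ⊆ Cᶜ :=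
  (segment_add_smul_subset (convex_Ico _ _) (B := (closure C)ᶜ) hw.notMem_closure hs ht).trans
    (compl_subset_compl.2 subset_closure)

lemma mem_rayGraph {w : Space d} (hw : IsRegular C φ w) {s : ℝ}
    (hs : s ∈ Ico 0 (hitTime C φ w)) : (w, w + s • rayDir φ w) ∈ rayGraph C φ := by
  have h1 := hw.segment_subset ⟨le_rfl, hw.hitTime_pos⟩ hs
  rw [zero_smul, add_zero] at h1
  refine mem_rayGraph_of_segment h1 ?_
  have h2 := dist_add_smul_add_smul (w := w) hw.norm_rayDir 0 s
  rw [zero_smul, add_zero, zero_sub, abs_neg, abs_of_nonneg hs.1] at h2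
  rw [h2, hw.potential_eq s ⟨hs.1, hs.2.le⟩]
  ring

end IsRegular

/-! ### Sets that meet every ray in at most one point -/

lemma measurable_rayDir (φ : Space d → ℝ) : Measurable (rayDir φ) := by
  have h : Measurable fun w => (InnerProductSpace.toDual ℝ (Space d)).symm (fderiv ℝ φ w) :=
    (InnerProductSpace.toDual ℝ (Space d)).symm.continuous.measurable.comp (measurable_fderiv ℝ φ)
  exact h.neg

/-- At points that lie in the middle of two rays of length `2 * s`, the direction of the ray is
`s⁻¹`-Lipschitz: compare the lengths of the two diagonals with the drops of the potential. -/
lemma IsRegular.mul_norm_sub_le (hφ : IsObstacleLipschitz C φ) {B : Set (Space d)}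
    (hB : Convex ℝ B) (hBC : B ⊆ Cᶜ) {w₁ w₂ : Space d} (h₁ : IsRegular C φ w₁)
    (h₂ : IsRegular C φ w₂) {s t₁ t₂ : ℝ} (hs : 0 ≤ s) (hs₁ : s ≤ t₁) (hs₂ : s ≤ t₂)
    (ht₁ : t₁ + s ≤ hitTime C φ w₁) (ht₂ : t₂ + s ≤ hitTime C φ w₂)
    (hB₁ : w₁ + (t₁ - s) • rayDir φ w₁ ∈ B) (hB₁' : w₁ + (t₁ + s) • rayDir φ w₁ ∈ B)
    (hB₂ : w₂ + (t₂ - s) • rayDir φ w₂ ∈ B) (hB₂' : w₂ + (t₂ + s) • rayDir φ w₂ ∈ B) :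
    s * ‖rayDir φ w₁ - rayDir φ w₂‖
      ≤ ‖w₁ + t₁ • rayDir φ w₁ - (w₂ + t₂ • rayDir φ w₂)‖ := by
  set u₁ := rayDir φ w₁
  set u₂ := rayDir φ w₂
  have hd₁ := hφ.sub_le_dist ((hB.segment_subset hB₁ hB₂').trans hBC)
  have hd₂ := hφ.sub_le_dist ((hB.segment_subset hB₂ hB₁').trans hBC)
  rw [h₁.potential_eq _ ⟨sub_nonneg.2 hs₁, by linarith⟩,
    h₂.potential_eq _ ⟨by linarith, ht₂⟩] at hd₁
  rw [h₂.potential_eq _ ⟨sub_nonneg.2 hs₂, by linarith⟩,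
    h₁.potential_eq _ ⟨by linarith, ht₁⟩] at hd₂
  set a := w₁ + t₁ • u₁ - (w₂ + t₂ • u₂) with ha
  set b := s • (u₁ + u₂) with hb
  have e₁ : dist (w₁ + (t₁ - s) • u₁) (w₂ + (t₂ + s) • u₂) = ‖a - b‖ := by
    rw [dist_eq_norm, ha, hb]
    congr 1
    module
  have e₂ : dist (w₂ + (t₂ - s) • u₂) (w₁ + (t₁ + s) • u₁) = ‖a + b‖ := by
    rw [dist_comm, dist_eq_norm, ha, hb]
    congr 1
    module
  rw [e₁] at hd₁
  rw [e₂] at hd₂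
  have hab := parallelogram_law_with_norm ℝ a b
  have huu := parallelogram_law_with_norm ℝ u₁ u₂
  rw [h₁.norm_rayDir, h₂.norm_rayDir] at huu
  have hbn : ‖b‖ = s * ‖u₁ + u₂‖ := by rw [hb, norm_smul, Real.norm_of_nonneg hs]
  have hsum : 4 * s ≤ ‖a + b‖ + ‖a - b‖ := by linarith
  have hsq : (4 * s) ^ 2 ≤ (‖a + b‖ + ‖a - b‖) ^ 2 := by gcongr
  refine abs_le_of_sq_le_sq' ?_ (norm_nonneg a) |>.2
  rw [hbn] at hab
  nlinarith [sq_nonneg (‖a + b‖ - ‖a - b‖)]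

/-- A map that contracts distances on `B` by a factor at most `K` contracts Hausdorff measure by
a factor at most `K ^ r`. -/
lemma hausdorffMeasure_le_of_dist_le {E : Type*} [MetricSpace E] [MeasurableSpace E] [BorelSpace E]
    {B : Set E} {g : E → E} {K : ℝ≥0} {r : ℝ} (hr : 0 ≤ r)
    (h : ∀ x ∈ B, ∀ y ∈ B, dist x y ≤ K * dist (g x) (g y)) :
    Measure.hausdorffMeasure r B ≤ (K : ℝ≥0∞) ^ r * Measure.hausdorffMeasure r (g '' B) := by
  rcases B.eq_empty_or_nonempty with rfl | ⟨x₀, hx₀⟩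
  · simp
  have : Nonempty E := ⟨x₀⟩
  have hinj : InjOn g B := fun x hx y hy hxy => by
    have h1 := h x hx y hy
    rw [hxy, dist_self, mul_zero] at h1
    exact dist_le_zero.1 h1
  have hleft := hinj.leftInvOn_invFunOn
  have hlip : LipschitzOnWith K (Function.invFunOn g B) (g '' B) := by
    refine LipschitzOnWith.of_dist_le_mul ?_
    rintro _ ⟨x, hx, rfl⟩ _ ⟨y, hy, rfl⟩
    rw [hleft hx, hleft hy]
    exact h x hx y hy
  have := hlip.hausdorffMeasure_image_le hr
  rwa [hleft.image_image] at this

/-- Local form of `volume_eq_zero_of_ray_subsingleton`. The images of `B` under the flow along the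
rays at infinitely many small times are disjoint, stay in a ball and have measure at least
`2 ^ (-d)` times that of `B`. -/
lemma hausdorffMeasure_eq_zero_of_subset_ball (hφ : IsObstacleLipschitz C φ) {c : Space d} {R : ℝ}
    (hR : 0 < R) (hball : Metric.ball c (3 * R) ⊆ (closure C)ᶜ) {B : Set (Space d)}
    (hB : MeasurableSet B) (hBR : B ⊆ Metric.ball c R) (hreg : ∀ w ∈ B, IsRegular C φ w)
    (hray : ∀ w ∈ B, ∀ w' ∈ B, ∀ s ∈ Ioo 0 (hitTime C φ w), w' ≠ w + s • rayDir φ w) :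
    Measure.hausdorffMeasure (Module.finrank ℝ (Space d) : ℝ) B = 0 := by
  set m : Measure (Space d) := Measure.hausdorffMeasure (Module.finrank ℝ (Space d) : ℝ) with hm
  have hballC : Metric.ball c (3 * R) ⊆ Cᶜ := hball.trans (compl_subset_compl.2 subset_closure)
  have hconv : Convex ℝ (Metric.ball c (3 * R)) := convex_ball _ _
  have hmove : ∀ w ∈ B, ∀ t, 0 ≤ t → dist (w + t • rayDir φ w) c < R + t := by
    intro w hw t ht
    refine (dist_triangle _ w _).trans_lt ?_
    rw [dist_eq_norm, add_sub_cancel_left, norm_smul, (hreg w hw).norm_rayDir, mul_one,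
      Real.norm_of_nonneg ht]
    linarith [Metric.mem_ball.1 (hBR hw)]
  have hmem : ∀ w ∈ B, ∀ t, 0 ≤ t → t ≤ 2 * R → w + t • rayDir φ w ∈ Metric.ball c (3 * R) :=
    fun w hw t ht htR => Metric.mem_ball.2 ((hmove w hw t ht).trans_le (by linarith))
  have hhit : ∀ w ∈ B, 2 * R < hitTime C φ w := by
    intro w hw
    by_contra! h
    exact hball (hmem w hw _ (hreg w hw).hitTime_pos.le h) (hreg w hw).hit
  set g : ℝ → Space d → Space d := fun s w => w + s • rayDir φ w with hg
  have hgmeas : ∀ s, Measurable (g s) := fun s =>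
    measurable_id.add ((measurable_rayDir φ).const_smul s)
  have hcomp : ∀ s, 0 ≤ s → s ≤ R → ∀ w ∈ B, ∀ w' ∈ B,
      dist w w' ≤ (2 : ℝ≥0) * dist (g s w) (g s w') := by
    intro s hs hsR w hw w' hw'
    have h1 := IsRegular.mul_norm_sub_le hφ hconv hballC (hreg w hw) (hreg w' hw') hs le_rfl le_rfl
      (by linarith [hhit w hw]) (by linarith [hhit w' hw'])
      (hmem w hw _ (by linarith) (by linarith)) (hmem w hw _ (by linarith) (by linarith))
      (hmem w' hw' _ (by linarith) (by linarith)) (hmem w' hw' _ (by linarith) (by linarith))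
    have h2 : w - w' = (g s w - g s w') - s • (rayDir φ w - rayDir φ w') := by
      simp only [hg]
      module
    rw [dist_eq_norm, dist_eq_norm, h2]
    refine (norm_sub_le _ _).trans ?_
    rw [norm_smul, Real.norm_of_nonneg hs]
    push_cast
    linarith
  have hdisj : ∀ s s', 0 < s → s < s' → s' ≤ R → Disjoint (g s '' B) (g s' '' B) := by
    intro s s' hs hss' hs'R
    rw [Set.disjoint_left]
    rintro _ ⟨w, hw, rfl⟩ ⟨w', hw', heq⟩
    simp only [hg] at heq
    -- the two rays cross in the interior of both, hence they have the same direction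
    have h1 := IsRegular.mul_norm_sub_le hφ hconv hballC (hreg w hw) (hreg w' hw') hs.le
      (t₁ := s) (t₂ := s') le_rfl hss'.le
      (by linarith [hhit w hw]) (by linarith [hhit w' hw'])
      (hmem w hw _ (by linarith) (by linarith)) (hmem w hw _ (by linarith) (by linarith))
      (hmem w' hw' _ (by linarith) (by linarith)) (hmem w' hw' _ (by linarith) (by linarith))
    rw [heq, sub_self, norm_zero] at h1
    have h2 : rayDir φ w = rayDir φ w' := by
      rw [← sub_eq_zero, ← norm_le_zero_iff]
      by_contra! h
      nlinarith
    refine hray w' hw' w hw (s' - s) ⟨sub_pos.2 hss', by linarith [hhit w' hw']⟩ ?_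
    rw [sub_smul, ← add_sub_assoc, heq, h2, add_sub_cancel_right]
  set σ : ℕ → ℝ := fun k => R / (k + 1) with hσ
  have hσ0 : ∀ k, 0 < σ k := fun k => by positivity
  have hσR : ∀ k, σ k ≤ R := fun k => by
    refine div_le_self hR.le ?_
    linarith [Nat.cast_nonneg (α := ℝ) k]
  have hσlt : ∀ k l, k < l → σ l < σ k := fun k l hkl => by
    simp only [hσ]
    gcongr
  have hpair : Pairwise (Function.onFun Disjoint fun k => g (σ k) '' B) := by
    intro k l hkl
    rcases hkl.lt_or_gt with h | h
    · exact (hdisj _ _ (hσ0 l) (hσlt _ _ h) (hσR k)).symm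
    · exact hdisj _ _ (hσ0 k) (hσlt _ _ h) (hσR l)
  have himg : ∀ k, MeasurableSet (g (σ k) '' B) := by
    intro k
    refine hB.image_of_measurable_injOn (hgmeas _) fun x hx y hy hxy => ?_
    have h1 := hcomp _ (hσ0 k).le (hσR k) x hx y hy
    rw [hxy, dist_self, mul_zero] at h1
    exact dist_le_zero.1 h1
  have hsub : ⋃ k, g (σ k) '' B ⊆ Metric.ball c (2 * R) := by
    refine iUnion_subset fun k => ?_
    rintro _ ⟨w, hw, rfl⟩
    exact Metric.mem_ball.2 ((hmove w hw _ (hσ0 k).le).trans_le (by linarith [hσR k]))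
  by_contra hne
  set K : ℝ≥0∞ := ((2 : ℝ≥0) : ℝ≥0∞) ^ (Module.finrank ℝ (Space d) : ℝ) with hK
  have hKtop : K ≠ ∞ := ENNReal.rpow_ne_top_of_nonneg (Nat.cast_nonneg _) ENNReal.coe_ne_top
  have hle : ∀ k, m B ≤ K * m (g (σ k) '' B) := fun k =>
    hausdorffMeasure_le_of_dist_le (Nat.cast_nonneg _) (hcomp _ (hσ0 k).le (hσR k))
  have htop : (∞ : ℝ≥0∞) ≤ K * m (Metric.ball c (2 * R)) := by
    calc (∞ : ℝ≥0∞) = ∑' _ : ℕ, m B := (ENNReal.tsum_const_eq_top_of_ne_zero hne).symm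
      _ ≤ ∑' k, K * m (g (σ k) '' B) := ENNReal.tsum_le_tsum hle
      _ = K * m (⋃ k, g (σ k) '' B) := by rw [ENNReal.tsum_mul_left, measure_iUnion hpair himg]
      _ ≤ _ := by gcongr
  exact (ENNReal.mul_lt_top hKtop.lt_top measure_ball_lt_top).not_ge htop

/-- A measurable set of regular points that meets every ray in at most one point is negligible. -/
theorem volume_eq_zero_of_ray_subsingleton (hφ : IsObstacleLipschitz C φ) {B : Set (Space d)}
    (hB : MeasurableSet B) (hreg : ∀ w ∈ B, IsRegular C φ w)
    (hray : ∀ w ∈ B, ∀ w' ∈ B, ∀ s ∈ Ioo 0 (hitTime C φ w), w' ≠ w + s • rayDir φ w) :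
    volume B = 0 := by
  refine Measure.absolutelyContinuous_isAddHaarMeasure volume
    (Measure.hausdorffMeasure (Module.finrank ℝ (Space d) : ℝ)) ?_
  refine measure_null_of_locally_null B fun w hw => ?_
  obtain ⟨r, hr, hball⟩ := exists_closedBall_subset_compl (hreg w hw).notMem
  refine ⟨B ∩ Metric.ball w (r / 3),
    inter_mem_nhdsWithin B (Metric.ball_mem_nhds w (by positivity)),
    hausdorffMeasure_eq_zero_of_subset_ball hφ (R := r / 3) (by positivity) ?_
      (hB.inter measurableSet_ball) inter_subset_right (fun x hx => hreg x hx.1)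
      (fun x hx y hy => hray x hx.1 y hy.1)⟩
  rw [mul_div_cancel₀ r three_ne_zero]
  exact Metric.ball_subset_closedBall.trans hball

/-! ### Atoms of iterated disintegrations -/

lemma exists_countable_piSystem (E : Type*) [mE : MeasurableSpace E] [StandardBorelSpace E] :
    ∃ P : Set (Set E), P.Countable ∧ IsPiSystem P ∧ mE = MeasurableSpace.generateFrom P := by
  refine ⟨preimage (embeddingReal E) '' (⋃ a : ℚ, {Iic (a : ℝ)}),
    (countable_iUnion fun _ => countable_singleton _).image _, ?_, ?_⟩
  · exact Real.isPiSystem_Iic_rat.comap (embeddingReal E)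
  · rw [← MeasurableSpace.comap_generateFrom, ← Real.borel_eq_generateFrom_Iic_rat,
      ← BorelSpace.measurable_eq (α := ℝ)]
    exact (measurableEmbedding_embeddingReal E).comap_eq.symm

namespace IsDisintegration

variable {E S : Type*} [MeasurableSpace E] [MeasurableSpace S]
  {ρ : Measure E} {r r' : E → S} {κ κ' : S → Measure E}

lemma congr (h : IsDisintegration ρ r κ) (hr : r =ᵐ[ρ] r') : IsDisintegration ρ r' κ where
  isProbabilityMeasure := h.isProbabilityMeasure
  aemeasurable B hB := by
    rw [← Measure.map_congr hr]
    exact h.aemeasurable B hB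
  consistent B D hB hD := by
    rw [← Measure.map_congr hr, ← h.consistent B D hB hD]
    refine measure_congr (eventuallyEq_set.2 ?_)
    filter_upwards [hr] with x hx
    simp [hx]

/-- Null sets of `ρ` are null sets of almost every conditional measure. -/
lemma ae_ae (h : IsDisintegration ρ r κ) {p : E → Prop} (hp : ∀ᵐ x ∂ρ, p x) :
    ∀ᵐ s ∂(ρ.map r), ∀ᵐ x ∂(κ s), p x := by
  obtain ⟨N, hpN, hN, hN0⟩ := exists_measurable_superset_of_null hp
  have h1 := h.consistent N univ hN MeasurableSet.univ
  rw [preimage_univ, inter_univ, hN0, setLIntegral_univ] at h1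
  filter_upwards [(lintegral_eq_zero_iff' (h.aemeasurable N hN)).1 h1.symm] with s hs
  exact measure_mono_null hpN hs

variable [StandardBorelSpace E] [IsProbabilityMeasure ρ]

/-- A disintegration is given by a Markov kernel, up to a null set of parameters. -/
lemma exists_kernel (h : IsDisintegration ρ r κ) :
    ∃ K : Kernel S E, IsMarkovKernel K ∧ ∀ᵐ s ∂(ρ.map r), K s = κ s := by
  classical
  obtain ⟨P, hPc, hPpi, hPgen⟩ := exists_countable_piSystem E
  have hPm : ∀ B ∈ P, MeasurableSet B := fun B hB => by
    rw [hPgen]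
    exact MeasurableSpace.measurableSet_generateFrom hB
  have hae : ∀ᵐ s ∂(ρ.map r), ∀ B, ∀ hB : B ∈ P, κ s B = (h.aemeasurable B (hPm B hB)).mk _ s :=
    (ae_ball_iff hPc).2 fun B hB => (h.aemeasurable B (hPm B hB)).ae_eq_mk
  obtain ⟨N, hN, hNm, hN0⟩ := exists_measurable_superset_of_null hae
  have hprob : ∀ s, IsProbabilityMeasure (if s ∈ N then ρ else κ s) := fun s => by
    split_ifs
    · infer_instance
    · exact h.isProbabilityMeasure s
  refine ⟨⟨fun s => if s ∈ N then ρ else κ s, ?_⟩, ⟨hprob⟩, ?_⟩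
  · refine Measurable.measure_of_isPiSystem_of_isProbabilityMeasure hPgen hPpi fun B hB => ?_
    have h1 : (fun s => (if s ∈ N then ρ else κ s) B)
        = fun s => if s ∈ N then ρ B else (h.aemeasurable B (hPm B hB)).mk _ s := by
      funext s
      split_ifs with hs
      · rfl
      · by_contra hne
        exact hs (hN fun hall => hne (hall B hB))
    rw [h1]
    exact Measurable.ite hNm measurable_const (h.aemeasurable B (hPm B hB)).measurable_mk
  · filter_upwards [measure_eq_zero_iff_ae_notMem.1 hN0] with s hs
    exact if_neg hs

/-- Disintegrations are essentially unique. -/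
lemma ae_eq (h : IsDisintegration ρ r κ) (h' : IsDisintegration ρ r κ') :
    ∀ᵐ s ∂(ρ.map r), κ s = κ' s := by
  obtain ⟨P, hPc, hPpi, hPgen⟩ := exists_countable_piSystem E
  have hPm : ∀ B ∈ P, MeasurableSet B := fun B hB => by
    rw [hPgen]
    exact MeasurableSpace.measurableSet_generateFrom hB
  have hae : ∀ᵐ s ∂(ρ.map r), ∀ B ∈ P, κ s B = κ' s B := by
    refine (ae_ball_iff hPc).2 fun B hB => ?_
    refine ae_eq_of_forall_setLIntegral_eq_of_sigmaFinite₀ (h.aemeasurable B (hPm B hB))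
      (h'.aemeasurable B (hPm B hB)) fun D hD _ => ?_
    rw [← h.consistent B D (hPm B hB) hD, h'.consistent B D (hPm B hB) hD]
  filter_upwards [hae] with s hs
  have := h.isProbabilityMeasure s
  have := h'.isProbabilityMeasure s
  exact ext_of_generate_finite P hPgen hPpi hs (by simp)

end IsDisintegration

/-- The atoms of a kernel are covered by countably many measurable graphs over its parameter
space. For an embedding `ι` in the real line, the graph with index `c` picks the point at which
the distribution function of the kernel jumps across the level `c`. -/
lemma exists_graphs_cover_atoms {T E : Type*} [MeasurableSpace T] [MeasurableSpace E]
    [StandardBorelSpace E] (η : Kernel T E) [IsMarkovKernel η] :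
    ∃ Γ : ℚ → Set (T × E), (∀ c, MeasurableSet (Γ c)) ∧
      (∀ c t x y, (t, x) ∈ Γ c → (t, y) ∈ Γ c → x = y) ∧
      ∀ t x, η t {x} ≠ 0 → ∃ c, (t, x) ∈ Γ c := by
  set ι := embeddingReal E
  have hι : MeasurableEmbedding ι := measurableEmbedding_embeddingReal E
  set F : T × E → ℝ := fun p => (η p.1).real {y | ι y < ι p.2} with hF
  set F' : T × E → ℝ := fun p => (η p.1).real {y | ι y ≤ ι p.2} with hF'
  have hFm : Measurable F := by
    have hs : MeasurableSet {p : (T × E) × E | ι p.2 < ι p.1.2} :=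
      measurableSet_lt (hι.measurable.comp measurable_snd)
        (hι.measurable.comp (measurable_snd.comp measurable_fst))
    exact (Kernel.measurable_kernel_prodMk_left (κ := η.comap Prod.fst measurable_fst)
      hs).ennreal_toReal
  have hFm' : Measurable F' := by
    have hs : MeasurableSet {p : (T × E) × E | ι p.2 ≤ ι p.1.2} :=
      measurableSet_le (hι.measurable.comp measurable_snd)
        (hι.measurable.comp (measurable_snd.comp measurable_fst))
    exact (Kernel.measurable_kernel_prodMk_left (κ := η.comap Prod.fst measurable_fst)
      hs).ennreal_toReal
  refine ⟨fun c => {p | F p < c ∧ c < F' p}, fun c =>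
    (measurableSet_lt hFm measurable_const).inter (measurableSet_lt measurable_const hFm'),
    fun c t x y hx hy => ?_, fun t x hx => ?_⟩
  · have key : ∀ x y, (c : ℝ) < F' (t, x) → F (t, y) < c → ¬ ι x < ι y := by
      intro x y hx hy hlt
      have : F' (t, x) ≤ F (t, y) := measureReal_mono fun z hz => lt_of_le_of_lt hz hlt
      linarith
    exact hι.injective (le_antisymm (not_lt.1 (key y x hy.2 hx.1)) (not_lt.1 (key x y hx.2 hy.1)))
  · have hdecomp : {y | ι y ≤ ι x} = {y | ι y < ι x} ∪ {x} := by
      ext y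
      simp [le_iff_lt_or_eq, hι.injective.eq_iff, or_comm]
    have hlt : F (t, x) < F' (t, x) := by
      have h1 : F' (t, x) = F (t, x) + (η t).real {x} := by
        simp only [hF, hF', hdecomp]
        exact measureReal_union (by simp) (measurableSet_singleton x)
      have h2 : 0 < (η t).real {x} :=
        ENNReal.toReal_pos hx (measure_ne_top _ _)
      linarith
    obtain ⟨c, hc⟩ := exists_rat_btwn hlt
    exact ⟨c, hc⟩

/-- If every measurable set on which `(q, f)` is injective is negligible, then the disintegration
with respect to `q` and then with respect to `f` is atomless. -/
theorem ae_ae_atomless_of_injOn_null {E Z S : Type*} [MeasurableSpace E] [StandardBorelSpace E]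
    [Nonempty E] [MeasurableSpace Z] [MeasurableSpace.CountablyGenerated Z] [MeasurableSpace S]
    {ρ : Measure E} [IsProbabilityMeasure ρ] {q : E → S} {f : E → Z} (hq : Measurable q)
    (hf : Measurable f)
    (hnull : ∀ B, MeasurableSet B → (∀ x ∈ B, ∀ y ∈ B, q x = q y → f x = f y → x = y) → ρ B = 0)
    {κ : S → Measure E} (hκ : IsDisintegration ρ q κ) {η : S → Z → Measure E}
    (hη : ∀ᵐ s ∂(ρ.map q), IsDisintegration (κ s) f (η s)) :
    ∀ᵐ s ∂(ρ.map q), ∀ᵐ z ∂((κ s).map f), ∀ x, η s z {x} = 0 := by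
  obtain ⟨K, hK, hKκ⟩ := hκ.exists_kernel
  have : IsProbabilityMeasure (ρ.map q) := Measure.isProbabilityMeasure_map hq.aemeasurable
  have hgm : Measurable fun x : E => (f x, x) := hf.prodMk measurable_id
  have hqm : Measurable fun x : E => (q x, x) := hq.prodMk measurable_id
  set L : Kernel S (Z × E) := K.map fun x => (f x, x) with hL
  have : IsMarkovKernel L := Kernel.IsMarkovKernel.map K hgm
  set J : Kernel (S × Z) E := L.condKernel with hJ
  have hLJ : L.fst ⊗ₖ J = L := L.disintegrate J
  have hLs : ∀ s, L s = (K s).map fun x => (f x, x) := fun s => Kernel.map_apply _ hgm _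
  have hLfst : ∀ s, L.fst s = (K s).map f := fun s => by
    rw [Kernel.fst_apply, hLs, Measure.map_map measurable_fst hgm]
    rfl
  have hJdis : ∀ s, IsDisintegration (K s) f fun z => J (s, z) := fun s =>
    { isProbabilityMeasure := fun z => inferInstance
      aemeasurable := fun B hB =>
        ((J.measurable_coe hB).comp measurable_prodMk_left).aemeasurable
      consistent := fun B D hB hD => by
        have h1 : K s (B ∩ f ⁻¹' D) = L s (D ×ˢ B) := by
          rw [hLs, Measure.map_apply hgm (hD.prod hB)]
          congr 1
          ext x
          simp [and_comm]
        rw [h1, ← hLJ, Kernel.compProd_apply_prod hD hB, hLfst] }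
  have hprod : ρ.map (fun x => (q x, x)) = (ρ.map q) ⊗ₘ K := by
    refine Measure.ext_prod fun {D B} hD hB => ?_
    rw [Measure.map_apply hqm (hD.prod hB), Measure.compProd_apply_prod hD hB]
    have h1 : (fun x => (q x, x)) ⁻¹' D ×ˢ B = B ∩ q ⁻¹' D := by
      ext x
      simp [and_comm]
    rw [h1, hκ.consistent B D hB hD]
    refine lintegral_congr_ae (ae_restrict_of_ae ?_)
    filter_upwards [hKκ] with s hs
    rw [hs]
  obtain ⟨Γ, hΓm, hΓinj, hΓ⟩ := exists_graphs_cover_atoms J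
  have hΓnull : ∀ᵐ s ∂(ρ.map q), ∀ᵐ z ∂((K s).map f), ∀ c, ∀ᵐ x ∂(J (s, z)),
      ((s, z), x) ∉ Γ c := by
    have h1 : ∀ c, ∀ᵐ x ∂ρ, ((q x, f x), x) ∉ Γ c := fun c => by
      refine measure_eq_zero_iff_ae_notMem.1 (hnull _
        (((hq.prodMk hf).prodMk measurable_id) (hΓm c)) fun x hx y hy hqxy hfxy => ?_)
      refine hΓinj c (q x, f x) x y hx ?_
      rw [hqxy, hfxy]
      exact hy
    have h2 : ∀ᵐ p ∂(ρ.map fun x => (q x, x)), ∀ c, ((p.1, f p.2), p.2) ∉ Γ c := by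
      refine ae_all_iff.2 fun c => ?_
      rw [ae_map_iff hqm.aemeasurable]
      · exact h1 c
      · exact ((measurable_fst.prodMk (hf.comp measurable_snd)).prodMk measurable_snd
          (hΓm c)).compl
    rw [hprod] at h2
    filter_upwards [Measure.ae_ae_of_ae_compProd h2] with s hs
    have h3 : ∀ᵐ p ∂(L s), ∀ c, ((s, p.1), p.2) ∉ Γ c := by
      rw [hLs]
      refine ae_all_iff.2 fun c => ?_
      rw [ae_map_iff hgm.aemeasurable]
      · filter_upwards [hs] with x hx using hx c
      · exact (((measurable_const.prodMk measurable_fst).prodMk measurable_snd) (hΓm c)).compl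
    rw [← hLJ] at h3
    have h4 := Kernel.ae_ae_of_ae_compProd h3
    rw [hLfst] at h4
    filter_upwards [h4] with z hz
    exact ae_all_iff.1 hz
  filter_upwards [hKκ, hη, hΓnull] with s hs hηs hΓs
  have : IsProbabilityMeasure (κ s) := hκ.isProbabilityMeasure s
  have hJs := hJdis s
  rw [hs] at hJs hΓs
  filter_upwards [hηs.ae_eq hJs, hΓs] with z hz hΓz x
  rw [hz]
  by_contra hne
  obtain ⟨c, hc⟩ := hΓ (s, z) x hne
  refine hne (measure_mono_null ?_ (hΓz c))
  rintro y rfl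
  exact not_not.2 hc

/-! ### Almost every point is regular and interior to a ray -/

lemma IsObstacleLipschitz.ae_differentiableAt (hφ : IsObstacleLipschitz C φ) :
    ∀ᵐ w : Space d, w ∉ closure C → DifferentiableAt ℝ φ w := by
  refine measure_null_of_locally_null _ fun w hw => ?_
  have hwC : w ∉ closure C := fun h => hw fun h' => absurd h h'
  obtain ⟨r, hr, hball⟩ := exists_closedBall_subset_compl hwC
  have hL := hφ.lipschitzOnWith (convex_ball w r) (Metric.ball_subset_closedBall.trans
    (hball.trans (compl_subset_compl.2 subset_closure)))
  refine ⟨_, inter_mem_nhdsWithin _ (Metric.ball_mem_nhds w hr), ?_⟩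
  refine measure_mono_null ?_ (hL.ae_differentiableWithinAt_of_mem (μ := volume))
  rintro x ⟨hx, hxr⟩ h
  exact hx fun _ => (h hxr).differentiableAt (Metric.isOpen_ball.mem_nhds hxr)

lemma ae_isRegular (hφ : IsObstacleLipschitz C φ) (hC : IsOpen C) (hconv : Convex ℝ C)
    {μ : Measure (Space d)} (hμC : μ C = 0) (hμ : μ ≪ volume)
    (hM : ∀ᵐ w ∂μ, ∃ z ∈ frontier C, (w, z) ∈ rayGraph C φ) : ∀ᵐ w ∂μ, IsRegular C φ w := by
  have hfront : μ (frontier C) = 0 := hμ (hconv.addHaar_frontier volume)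
  filter_upwards [hM, hμ.ae_le hφ.ae_differentiableAt, measure_eq_zero_iff_ae_notMem.1 hμC,
    measure_eq_zero_iff_ae_notMem.1 hfront] with w hw hd hwC hwF
  have hcl : w ∉ closure C := fun h => hwF (hC.frontier_eq ▸ ⟨h, hwC⟩)
  exact hφ.isRegular hC hcl (hd hcl) hw

/-- Initial points of rays are negligible, because no point of a ray but the first one is
initial. -/
lemma ae_mem_transportSet (hφ : IsObstacleLipschitz C φ) {μ : Measure (Space d)}
    (hμ : μ ≪ volume) (hreg : ∀ᵐ w ∂μ, IsRegular C φ w) : ∀ᵐ w ∂μ, w ∈ transportSet C φ := by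
  classical
  obtain ⟨N₀, hN₀, hN₀m, hμN₀⟩ := exists_measurable_superset_of_null hreg
  have hregN₀ : ∀ w ∉ N₀, IsRegular C φ w := fun w hw => by
    by_contra h
    exact hw (hN₀ h)
  have hcont : ContinuousOn φ (closure C)ᶜ := fun w hw => by
    obtain ⟨r, hr, hball⟩ := exists_closedBall_subset_compl hw
    exact ((hφ.lipschitzOnWith (convex_closedBall w r) (hball.trans
      (compl_subset_compl.2 subset_closure))).continuousOn.continuousAt
      (Metric.closedBall_mem_nhds w hr)).continuousWithinAt
  -- `φ` is arbitrary inside the obstacle; `φ'` is a measurable function that agrees with it outside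
  set φ' : Space d → ℝ := (closure C)ᶜ.piecewise φ fun _ => 0 with hφ'
  have hφ'm : Measurable φ' :=
    hcont.measurable_piecewise continuousOn_const isClosed_closure.measurableSet.compl
  have hφ'eq : ∀ x ∉ closure C, φ' x = φ x := fun x hx => piecewise_eq_of_mem _ _ _ hx
  set δ : Space d → ℝ := fun w => Metric.infDist w (closure C) with hδ
  set σ : ℕ → ℝ := fun n => 1 / ((n : ℝ) + 1) with hσ
  have hσ0 : ∀ n, 0 < σ n := fun n => Nat.one_div_pos_of_nat
  set B : Set (Space d) := N₀ᶜ ∩ ⋂ n, {w | σ n < δ w → φ' (w - σ n • rayDir φ w) ≠ φ' w + σ n}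
    with hB
  have hBm : MeasurableSet B := by
    refine hN₀m.compl.inter (MeasurableSet.iInter fun n => ?_)
    have h1 : MeasurableSet {w | σ n < δ w} :=
      measurableSet_lt measurable_const (Metric.continuous_infDist_pt _).measurable
    have h2 : MeasurableSet {w | φ' (w - σ n • rayDir φ w) = φ' w + σ n} :=
      measurableSet_eq_fun (hφ'm.comp (measurable_id.sub ((measurable_rayDir φ).const_smul (σ n))))
        (hφ'm.add_const _)
    exact h1.imp h2.compl
  have hback : ∀ w, IsRegular C φ w → ∀ t, 0 ≤ t → t < δ w → ∀ x ∈ Metric.closedBall w t,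
      x ∉ closure C := fun w hw t ht htδ x hx =>
    Metric.notMem_of_dist_lt_infDist (x := w) ((Metric.mem_closedBall'.1 hx).trans_lt htδ)
  have hmemball : ∀ w, IsRegular C φ w → ∀ t, 0 ≤ t →
      w - t • rayDir φ w ∈ Metric.closedBall w t := fun w hw t ht => by
    rw [Metric.mem_closedBall, dist_eq_norm, sub_sub_cancel_left, norm_neg, norm_smul,
      hw.norm_rayDir, mul_one, Real.norm_of_nonneg ht]
  have hBnull : μ B = 0 := by
    refine hμ (volume_eq_zero_of_ray_subsingleton hφ hBm (fun w hw => hregN₀ w hw.1) ?_)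
    intro w hw w' hw' s hs h
    have hwr := hregN₀ w hw.1
    have hwr' := hregN₀ w' hw'.1
    have hdir := (IsRegular.rayDir_and_hitTime_eq hφ hwr hwr' ⟨hs.1.le, hs.2⟩ h).1
    have hδ' : 0 < δ w' :=
      (isClosed_closure.notMem_iff_infDist_pos ⟨_, hwr'.hit⟩).1 hwr'.notMem
    obtain ⟨n, hn⟩ := exists_nat_one_div_lt (lt_min hs.1 hδ')
    have hns : σ n < s := hn.trans_le (min_le_left _ _)
    have hnδ : σ n < δ w' := hn.trans_le (min_le_right _ _)
    refine mem_iInter.1 hw'.2 n hnδ ?_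
    rw [hφ'eq _ (hback w' hwr' _ (hσ0 n).le hnδ _ (hmemball w' hwr' _ (hσ0 n).le)),
      hφ'eq _ hwr'.notMem, hdir]
    have h1 : w' - σ n • rayDir φ w = w + (s - σ n) • rayDir φ w := by rw [h]; module
    rw [h1, hwr.potential_eq _ ⟨by linarith, by linarith [hs.2, hσ0 n]⟩, h,
      hwr.potential_eq s ⟨hs.1.le, hs.2.le⟩]
    ring
  filter_upwards [measure_eq_zero_iff_ae_notMem.1 hμN₀, measure_eq_zero_iff_ae_notMem.1 hBnull]
    with w hwN hwB
  have hw := hregN₀ w hwN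
  have hne : ∀ t : ℝ, t ≠ 0 → t • rayDir φ w ≠ 0 := fun t ht =>
    smul_ne_zero ht (norm_ne_zero_iff.1 (by rw [hw.norm_rayDir]; exact one_ne_zero))
  constructor
  · have h1 : ∃ n, σ n < δ w ∧ φ' (w - σ n • rayDir φ w) = φ' w + σ n := by
      by_contra! h
      exact hwB ⟨hwN, mem_iInter.2 h⟩
    obtain ⟨n, hn, heq⟩ := h1
    have hmem := hmemball w hw _ (hσ0 n).le
    rw [hφ'eq _ (hback w hw _ (hσ0 n).le hn _ hmem), hφ'eq _ hw.notMem] at heq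
    refine ⟨w - σ n • rayDir φ w, by simpa using hne _ (hσ0 n).ne', ?_⟩
    refine mem_rayGraph_of_segment (fun x hx hxC => ?_) ?_
    · exact hback w hw _ (hσ0 n).le hn x ((convex_closedBall w (σ n)).segment_subset hmem
        (Metric.mem_closedBall_self (hσ0 n).le) hx) (subset_closure hxC)
    · rw [heq, dist_eq_norm, sub_sub_cancel_left, norm_neg, norm_smul, hw.norm_rayDir, mul_one,
        Real.norm_of_nonneg (hσ0 n).le]
      ring
  · have hpos := hw.hitTime_pos
    exact ⟨w + (hitTime C φ w / 2) • rayDir φ w, by simpa using hne _ (half_pos hpos).ne',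
      hw.mem_rayGraph ⟨by linarith, by linarith⟩⟩

lemma measurable_hitTime (C : Set (Space d)) (φ : Space d → ℝ) : Measurable (hitTime C φ) := by
  set Q : ℝ → Set (Space d) := fun t => {w | ∃ s ∈ Icc 0 t, w + s • rayDir φ w ∈ closure C} with hQ
  have hQm : ∀ t, MeasurableSet (Q t) := by
    intro t
    set A : Set (Icc (0 : ℝ) t × (Space d × Space d)) :=
      {p | p.2.1 + (p.1 : ℝ) • p.2.2 ∈ closure C} with hA
    have hAc : IsClosed A := isClosed_closure.preimage (by fun_prop)
    have h1 : IsClosed (Prod.snd '' A) := isClosedMap_snd_of_compactSpace A hAc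
    have h2 : Q t = (fun w => (w, rayDir φ w)) ⁻¹' (Prod.snd '' A) := by
      ext w
      constructor
      · rintro ⟨s, hs, h⟩
        exact ⟨⟨⟨s, hs⟩, (w, rayDir φ w)⟩, h, rfl⟩
      · rintro ⟨⟨⟨s, hs⟩, p⟩, h, hp⟩
        simp only at hp
        subst hp
        exact ⟨s, hs, h⟩
    rw [h2]
    exact (measurable_id.prodMk (measurable_rayDir φ)) h1.measurableSet
  refine measurable_of_Iic fun t => ?_
  have h3 : hitTime C φ ⁻¹' Iic t = {w | 0 ≤ t ∧ (w ∈ Q t ∨ w ∉ ⋃ n : ℕ, Q n)} := by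
    ext w
    have h0 : 0 ≤ hitTime C φ w := Real.sInf_nonneg fun s hs => hs.1
    constructor
    · intro h
      refine ⟨h0.trans h, or_iff_not_imp_right.2 fun h' => ?_⟩
      obtain ⟨n, s, hs, hsC⟩ := mem_iUnion.1 (not_not.1 h')
      have := (isClosed_setOf_hit (C := C) w (rayDir φ w)).csInf_mem ⟨s, hs.1, hsC⟩
        ⟨0, fun _ hs => hs.1⟩
      exact ⟨_, ⟨this.1, h⟩, this.2⟩
    · rintro ⟨ht, ⟨s, hs, hsC⟩ | hempty⟩
      · exact (hitTime_le hs.1 hsC).trans hs.2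
      · have h4 : {t : ℝ | 0 ≤ t ∧ w + t • rayDir φ w ∈ closure C} = ∅ := by
          refine eq_empty_of_forall_notMem fun s hs => hempty ?_
          obtain ⟨n, hn⟩ := exists_nat_ge s
          exact mem_iUnion.2 ⟨n, s, ⟨hs.1, hn⟩, hs.2⟩
        have h5 : hitTime C φ w = 0 := by rw [hitTime, h4, Real.sInf_empty]
        exact mem_preimage.2 (h5 ▸ mem_Iic.2 ht)
  rw [h3]
  by_cases ht : 0 ≤ t
  · simp only [ht, true_and]
    exact (hQm t).union (MeasurableSet.iUnion fun n : ℕ => hQm n).compl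
  · simp [ht]

lemma mem_chains_of_mem_rayGraph {x y : Space d} (hx : x ∈ transportSet C φ)
    (hy : y ∈ transportSet C φ) (h : (x, y) ∈ rayGraph C φ) : (x, y) ∈ chains C φ := by
  refine ⟨Or.inl hx.1, Or.inl hy.1, 0, fun i => if i = 0 then x else y, by simp, by simp,
    fun i h1 h2 => by omega, fun i hi => ?_⟩
  obtain rfl : i = 0 := by omega
  exact Or.inl (by simpa using h)

end ObstacleProblem

theorem propositionP {d : ℕ} {C : Set (ObstacleProblem.Space d)}
    (hC : ObstacleProblem.IsObstacle C)
    {μ ν : Measure (ObstacleProblem.Space d)} [IsProbabilityMeasure μ] [IsProbabilityMeasure ν]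
    (hμC : μ C = 0) (hνC : ν C = 0) (hμ : μ ≪ volume)
    {π : Measure (ObstacleProblem.Space d × ObstacleProblem.Space d)}
    (hπ : ObstacleProblem.IsOptimalPlan C μ ν π)
    {φ : ObstacleProblem.Space d → ℝ} (hφ : ObstacleProblem.IsPotential C π φ)
    (hM : ∀ᵐ w ∂μ, ∃ z ∈ frontier C, (w, z) ∈ ObstacleProblem.rayGraph C φ)
    {S : Type*} [MeasurableSpace S] {q : ObstacleProblem.Space d → S}
    (hq : ObstacleProblem.IsQuotientMap C φ μ q)
    {μY : S → Measure (ObstacleProblem.Space d)}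
    (hμY : ObstacleProblem.IsDisintegration μ q μY)
    {μYZ : S → ObstacleProblem.Space d → Measure (ObstacleProblem.Space d)}
    (hμYZ : ∀ᵐ y ∂(μ.map q),
      ObstacleProblem.IsDisintegration (μY y) (ObstacleProblem.contactMap C φ) (μYZ y)) :
    ∀ᵐ y ∂(μ.map q), ∀ᵐ z ∂((μY y).map (ObstacleProblem.contactMap C φ)),
      ∀ x, μYZ y z {x} = 0 := by
  open ObstacleProblem Set Filter in
  have hL : IsObstacleLipschitz C φ := hφ.lipschitz
  have hreg := ae_isRegular hL hC.isOpen hC.convex hμC hμ hM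
  have hT := ae_mem_transportSet hL hμ hreg
  set f : Space d → Space d := fun w => w + hitTime C φ w • rayDir φ w with hf
  have hfm : Measurable f := measurable_id.add ((measurable_hitTime C φ).smul (measurable_rayDir φ))
  have hfc : contactMap C φ =ᵐ[μ] f := by
    filter_upwards [hreg] with w hw using hw.contactMap_eq
  set q' := hq.aemeasurable.mk q with hq'
  have hqq' : q =ᵐ[μ] q' := hq.aemeasurable.ae_eq_mk
  have hmap : μ.map q = μ.map q' := Measure.map_congr hqq'
  have hfY : ∀ᵐ y ∂(μ.map q), contactMap C φ =ᵐ[μY y] f := hμY.ae_ae hfc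
  have hfYZ : ∀ᵐ y ∂(μ.map q), IsDisintegration (μY y) f (μYZ y) := by
    filter_upwards [hμYZ, hfY] with y hy hfy using hy.congr hfy
  have hnull : ∀ B, MeasurableSet B →
      (∀ x ∈ B, ∀ y ∈ B, q' x = q' y → f x = f y → x = y) → μ B = 0 := by
    intro B hB hinj
    have hgood : ∀ᵐ w ∂μ, IsRegular C φ w ∧ w ∈ transportSet C φ ∧ q w = q' w := by
      filter_upwards [hreg, hT, hqq'] with w h1 h2 h3 using ⟨h1, h2, h3⟩
    obtain ⟨N, hN, hNm, hμN⟩ := exists_measurable_superset_of_null hgood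
    have hgoodN : ∀ w ∉ N, IsRegular C φ w ∧ w ∈ transportSet C φ ∧ q w = q' w := fun w hw => by
      by_contra h
      exact hw (hN h)
    have h0 : μ (B \ N) = 0 := by
      refine hμ (volume_eq_zero_of_ray_subsingleton hL (hB.diff hNm)
        (fun w hw => (hgoodN w hw.2).1) ?_)
      -- two points of one ray have the same class and the same contact point
      intro w hw w' hw' s hs h
      obtain ⟨hr, ht, hqw⟩ := hgoodN w hw.2
      obtain ⟨hr', ht', hqw'⟩ := hgoodN w' hw'.2
      have hchain : (w, w') ∈ chains C φ :=
        mem_chains_of_mem_rayGraph ht ht' (h ▸ hr.mem_rayGraph ⟨hs.1.le, hs.2⟩)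
      have hcontact := IsRegular.contactMap_eq_of_ray hL hr hr' ⟨hs.1.le, hs.2⟩ h
      rw [hr.contactMap_eq, hr'.contactMap_eq] at hcontact
      have heq : w = w' := hinj w hw.1 w' hw'.1
        (by rw [← hqw, ← hqw']; exact (hq.eq_iff w ht w' ht').2 hchain) hcontact.symm
      rw [← heq, left_eq_add, smul_eq_zero] at h
      rcases h with h | h
      · exact hs.1.ne' h
      · have := hr.norm_rayDir
        rw [h, norm_zero] at this
        exact zero_ne_one this
    rw [← measure_sdiff_null hμN]
    exact h0
  rw [hmap] at hfYZ hfY ⊢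
  filter_upwards [ae_ae_atomless_of_injOn_null hq.aemeasurable.measurable_mk hfm hnull
    (hμY.congr hqq') hfYZ, hfY] with y hy hfy
  rw [Measure.map_congr hfy]
  exact hy
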